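/- Let $\zeta_1=1$, $\zeta_2=\frac12(-1+i\sqrt3)$, $\zeta_3=\frac12(-1-i\sqrt3)$, and let $a\ge 0$. Let $l$ be the union of the three rays $l_{\zeta_k}=\{x\zeta_k:x\ge 0\}$, and let $L^2(l,a)$ be the Hilbert space of functions $f$ on $l$, with components $f_k=f|_{l_{\zeta_k}}$, such that $$\|f\|^2=\sum_{k=1}^3\int_0^\infty e^{2ax}|f_k(x\zeta_k)|^2\,dx<\infty .$$ Put $$\widetilde f_k(\lambda)=(\mathcal F_{\zeta_k}f_k)(\lambda)=\int_0^\infty e^{-i\lambda\zeta_kx}f_k(x\zeta_k)\,dx\qquad(1\le k\le 3).$$ Let $\mathbb C_-(\zeta_k,a)=\{\zeta_k\eta:\operatorname{Im}\eta<a\}$, and let $H^2_-(\zeta_k,a)$ be the Hardy space of holomorphic functions $F$ on $\mathbb C_-(\zeta_k,a)$ with finite norm $$\|F\|=\sup_{\nu<a}\Big(\int_{\mathbb R}|F(\zeta_k(\mu+i\nu))|^2\,d\mu\Big)^{1/2}.$$ Let $L^2(L)$ be the Hilbert space of functions $g$ on the union $L$ of the lines $L_{\zeta_k}=\mathbb R\zeta_k$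 with $\|g\|^2=\sum_k\int_{\mathbb R}|g(x\zeta_k)|^2dx<\infty$, and let $T_a=\bigcap_k\overline{\mathbb C_-(\zeta_k,a)}$, that is, the closed equilateral triangle $$T_a=\{\mu+i\nu:\ \nu\le a,\ \nu\ge\sqrt3\mu-2a,\ \nu\ge-\sqrt3\mu-2a\}$$ (a single point if $a=0$). For a function $F$ on $\{\zeta(\mu+i\nu):\mu\in\mathbb R,\ \nu<s\}$, where $\zeta\in\{\zeta_1,\zeta_2,\zeta_3\}$, say that $g\in L^2(\mathbb R)$ is the value of $F$ on the line $\operatorname{Im}(\lambda/\zeta)=s$ if $F(\zeta(\mu+i\nu))\to g(\mu)$ as $\nu\uparrow s$, both in $L^2(d\mu)$ and for almost every $\mu$. **Theorem 1.2.** 1. For every $f\in L^2(l,a)$ the integrals $\widetilde f_1$, $\widetilde f_2$, $\widetilde f_3$ converge absolutely in $\mathbb C_-(\zeta_1,a)$, $\mathbb C_-(\zeta_3,a)$, $\mathbb C_-(\zeta_2,a)$ respectively, and $f\mapsto(\widetilde f_1,\widetilde f_3,\widetilde f_2)$ is an isomorphism (a linear homeomorphism) of $L^2(l,a)$ onto $H^2_-(\zeta_1,a)\oplus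 H^2_-(\zeta_2,a)\oplus H^2_-(\zeta_3,a)$, with $\|\widetilde f_1\|^2+\|\widetilde f_2\|^2+\|\widetilde f_3\|^2=2\pi\|f\|^2$. 2. The space $H^2_-(\zeta_1,a)\oplus H^2_-(\zeta_2,a)\oplus H^2_-(\zeta_3,a)$ lies in $L^2(L)$: taking the value of the $k$-th summand on the line $L_{\zeta_k}$ for each $k$ is a well-defined, injective, bounded linear map into $L^2(L)$. 3. Let $f\in L^2(l,a)$. The transforms exist throughout $T_a$, in the following sense. For $\lambda\in T_a$, the integral $\widetilde f_k(\lambda)$ converges absolutely for each $k$ such that $\lambda$ does not lie on the boundary line $\partial\mathbb C_-(\overline{\zeta_k},a)$ (for interior $\lambda$, for all three $k$). On the boundary line $\partial\mathbb C_-(\overline{\zeta_k},a)=\{\overline{\zeta_k}(\mu+ia):\mu\in\mathbb R\}$ the transform $\widetilde f_k$ exists in the sense of Plancherel: the truncated integrals $\int_0^N$ converge as $N\to\infty$ in $L^2$ of the line, and their limit is the value of $\widetilde f_k$ on this line; in particular $\widetilde f_k$ has a limit, along the normal from inside the half-plane, at almost every point of the line. All three $\widetilde f_k$ are holomorphic at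 every interior point of $T_a$. -/

import Mathlib

open MeasureTheory Set Filter Topology
open scoped ENNReal NNReal

namespace RayBundle

noncomputable section

/-- The three cube roots of unity `1`, `(-1 + i √3) / 2`, `(-1 - i √3) / 2`
(the mathematical index `1, 2, 3` is `0, 1, 2` here). -/
def zeta : Fin 3 → ℂ :=
  ![1, (-1 + Complex.I * (√3 : ℝ)) / 2, (-1 - Complex.I * (√3 : ℝ)) / 2]

/-- The index of the complex conjugate (equivalently, the inverse) of `zeta k`. -/
def conjIdx : Equiv.Perm (Fin 3) := Equiv.swap 1 2

/-! ### The weighted space on the bundle of rays -/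

/-- The measure `e^{2ax} dx` on the ray `{x ζ_k : x > 0}`, as a measure on the plane. -/
def rayMeasure (k : Fin 3) (a : ℝ) : Measure ℂ :=
  ((volume.restrict (Ioi (0 : ℝ))).withDensity
    (fun x => ENNReal.ofReal (Real.exp (2 * a * x)))).map (fun x : ℝ => (x : ℂ) * zeta k)

/-- The Hilbert space `L²(l, a)` of functions on the bundle `l` of the three rays, with norm
`‖f‖² = ∑ₖ ∫₀^∞ e^{2ax} |f(x ζ_k)|² dx`. The component `f_k` of `f` is its restriction to the
`k`-th ray. -/
abbrev L2Rays (a : ℝ) : Type := Lp ℂ 2 (∑ k : Fin 3, rayMeasure k a)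

/-- The Hilbert space `L²(L)` of functions on the bundle of the three full lines `ℝ ζ_k`, with
norm `‖g‖² = ∑ₖ ∫_ℝ |g(x ζ_k)|² dx`. -/
abbrev L2Lines : Type :=
  Lp ℂ 2 (∑ k : Fin 3, (volume : Measure ℝ).map (fun x : ℝ => (x : ℂ) * zeta k))

/-! ### The Fourier transforms on the rays -/

/-- The integrand `e^{-i z ζ_k x} f(x ζ_k)` of the `k`-th transform at the point `z`. -/
def rayIntegrand (k : Fin 3) (f : ℂ → ℂ) (z : ℂ) (x : ℝ) : ℂ :=
  Complex.exp (-Complex.I * z * zeta k * x) * f ((x : ℂ) * zeta k)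

/-- The Fourier transform `∫₀^∞ e^{-i z ζ_k x} f(x ζ_k) dx` along the `k`-th ray. -/
def rayFourier (k : Fin 3) (f : ℂ → ℂ) (z : ℂ) : ℂ :=
  ∫ x in Ioi (0 : ℝ), rayIntegrand k f z x

/-! ### Half-planes, the triangle, Hardy spaces -/

/-- The open half-plane `ℂ₋(ζ_k, a) = {ζ_k η : Im η < a}`. -/
def halfPlane (k : Fin 3) (a : ℝ) : Set ℂ :=
  {z | ∃ η : ℂ, η.im < a ∧ z = zeta k * η}

/-- The closed triangle `T_a`, the intersection of the three closed half-planes. -/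
def triangle (a : ℝ) : Set ℂ := ⋂ k : Fin 3, closure (halfPlane k a)

/-- The restriction of `F` to the line `{ζ_k (μ + iν) : μ ∈ ℝ}`, as a function of `μ`. -/
def slice (k : Fin 3) (F : ℂ → ℂ) (ν : ℝ) (μ : ℝ) : ℂ :=
  F (zeta k * ((μ : ℂ) + (ν : ℂ) * Complex.I))

/-- The functions holomorphic in `ℂ₋(ζ_k, a)` whose `L²` norms on the lines
`{ζ_k (μ + iν) : μ ∈ ℝ}`, `ν < a`, are uniformly bounded. Such a function lives on the half-plane
only; it is represented by its extension by `0`, so that distinct elements are distinct functions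
on the half-plane. -/
def hardySubmodule (k : Fin 3) (a : ℝ) : Submodule ℂ (ℂ → ℂ) where
  carrier := {F | DifferentiableOn ℂ F (halfPlane k a) ∧ (∀ z, z ∉ halfPlane k a → F z = 0) ∧
    ∃ C : ℝ≥0, ∀ ν < a, eLpNorm (slice k F ν) 2 volume ≤ C}
  zero_mem' := by
    refine ⟨differentiableOn_const (0 : ℂ), fun _ _ => rfl, 0, fun ν _ => ?_⟩
    have : slice k (0 : ℂ → ℂ) ν = 0 := rfl
    simp [this]
  add_mem' := by
    rintro F G ⟨hF, hF0, C, hC⟩ ⟨hG, hG0, D, hD⟩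
    refine ⟨hF.add hG, fun z hz => by simp [hF0 z hz, hG0 z hz], C + D, fun ν hν => ?_⟩
    have hs : ∀ H : ℂ → ℂ, DifferentiableOn ℂ H (halfPlane k a) →
        AEStronglyMeasurable (slice k H ν) volume := fun H hH =>
      (hH.continuousOn.comp_continuous (by fun_prop)
        (fun μ : ℝ => ⟨_, by simpa using hν, rfl⟩)).aestronglyMeasurable
    have : slice k (F + G) ν = slice k F ν + slice k G ν := rfl
    rw [this, ENNReal.coe_add]
    exact (eLpNorm_add_le (hs F hF) (hs G hG) (by norm_num)).trans
      (add_le_add (hC ν hν) (hD ν hν))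
  smul_mem' := by
    rintro c F ⟨hF, hF0, C, hC⟩
    refine ⟨hF.const_smul c, fun z hz => by simp [hF0 z hz], ‖c‖₊ * C, fun ν hν => ?_⟩
    have : slice k (c • F) ν = c • slice k F ν := rfl
    rw [this, eLpNorm_const_smul, ENNReal.coe_mul]
    exact mul_le_mul_right (hC ν hν) _

/-- The Hardy space `H²₋(ζ_k, a)` of the half-plane `ℂ₋(ζ_k, a)`. -/
def Hardy (k : Fin 3) (a : ℝ) : Type := ↥(hardySubmodule k a)

instance (k : Fin 3) (a : ℝ) : AddCommGroup (Hardy k a) :=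
  inferInstanceAs (AddCommGroup ↥(hardySubmodule k a))

instance (k : Fin 3) (a : ℝ) : Module ℂ (Hardy k a) :=
  inferInstanceAs (Module ℂ ↥(hardySubmodule k a))

/-- The function underlying an element of the Hardy space. -/
def Hardy.toFun {k : Fin 3} {a : ℝ} (F : Hardy k a) : ℂ → ℂ := F.1

/-- The Hardy norm before it is turned into a real number: the supremum of the `L²` norms on the
lines `{ζ_k (μ + iν) : μ ∈ ℝ}`, `ν < a`. -/
def Hardy.enormSup {k : Fin 3} {a : ℝ} (F : Hardy k a) : ℝ≥0∞ :=
  ⨆ ν : Iio a, eLpNorm (slice k F.toFun ν) 2 volume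

/-- The Hardy norm `‖F‖ = sup_{ν < a} (∫ |F(ζ_k (μ + iν))|² dμ)^{1/2}`. -/
instance (k : Fin 3) (a : ℝ) : Norm (Hardy k a) := ⟨fun F => F.enormSup.toReal⟩

theorem Hardy.enormSup_ne_top {k : Fin 3} {a : ℝ} (F : Hardy k a) : F.enormSup ≠ ∞ := by
  obtain ⟨C, hC⟩ := F.2.2.2
  exact ne_top_of_le_ne_top ENNReal.coe_ne_top (iSup_le fun ν => hC ν.1 ν.2)

theorem Hardy.continuous_slice {k : Fin 3} {a : ℝ} (F : Hardy k a) {ν : ℝ} (hν : ν < a) :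
    Continuous (slice k F.toFun ν) :=
  F.2.1.continuousOn.comp_continuous (by fun_prop)
    (fun μ : ℝ => ⟨_, by simpa using hν, rfl⟩)

theorem Hardy.normedSpaceCore (k : Fin 3) (a : ℝ) : NormedSpace.Core ℂ (Hardy k a) where
  norm_nonneg F := ENNReal.toReal_nonneg
  norm_smul c F := by
    have h : (c • F).enormSup = ‖c‖ₑ * F.enormSup := by
      unfold Hardy.enormSup
      rw [ENNReal.mul_iSup]
      refine iSup_congr fun ν => ?_
      have : slice k (c • F).toFun ν = c • slice k F.toFun ν := rfl
      rw [this, eLpNorm_const_smul]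
    change (c • F).enormSup.toReal = ‖c‖ * F.enormSup.toReal
    rw [h, ENNReal.toReal_mul, toReal_enorm]
  norm_triangle F G := by
    have h : (F + G).enormSup ≤ F.enormSup + G.enormSup := by
      refine iSup_le fun ν => ?_
      have : slice k (F + G).toFun ν = slice k F.toFun ν + slice k G.toFun ν := rfl
      rw [this]
      exact (eLpNorm_add_le (F.continuous_slice ν.2).aestronglyMeasurable
        (G.continuous_slice ν.2).aestronglyMeasurable (by norm_num)).trans
        (add_le_add (le_iSup (fun ν : Iio a => eLpNorm (slice k F.toFun ν) 2 volume) ν)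
          (le_iSup (fun ν : Iio a => eLpNorm (slice k G.toFun ν) 2 volume) ν))
    change (F + G).enormSup.toReal ≤ F.enormSup.toReal + G.enormSup.toReal
    rw [← ENNReal.toReal_add F.enormSup_ne_top G.enormSup_ne_top]
    exact ENNReal.toReal_mono (ENNReal.add_ne_top.2 ⟨F.enormSup_ne_top, G.enormSup_ne_top⟩) h
  norm_eq_zero_iff F := by
    constructor
    · intro h
      have h0 : F.enormSup = 0 :=
        ((ENNReal.toReal_eq_zero_iff _).1 h).resolve_right F.enormSup_ne_top
      refine Subtype.ext (funext fun z => ?_)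
      by_cases hz : z ∈ halfPlane k a
      · obtain ⟨η, hη, rfl⟩ := hz
        have h1 : eLpNorm (slice k F.toFun η.im) 2 volume = 0 :=
          (ENNReal.iSup_eq_zero.1 h0) ⟨η.im, hη⟩
        have hc := F.continuous_slice hη
        rw [eLpNorm_eq_zero_iff hc.aestronglyMeasurable (by norm_num)] at h1
        have h2 := (hc.ae_eq_iff_eq volume continuous_zero).1 h1
        have h3 := congrFun h2 η.re
        have h4 : F.toFun (zeta k * η) = 0 := by
          simpa [slice, Complex.re_add_im] using h3
        exact h4
      · exact F.2.2.1 z hz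
    · rintro rfl
      have h : (0 : Hardy k a).enormSup = 0 := by
        refine ENNReal.iSup_eq_zero.2 fun ν => ?_
        have : slice k (0 : Hardy k a).toFun ν = 0 := rfl
        simp [this]
      change (0 : Hardy k a).enormSup.toReal = 0
      rw [h, ENNReal.toReal_zero]

instance (k : Fin 3) (a : ℝ) : NormedAddCommGroup (Hardy k a) :=
  NormedAddCommGroup.ofCore (Hardy.normedSpaceCore k a)

instance (k : Fin 3) (a : ℝ) : NormedSpace ℂ (Hardy k a) :=
  NormedSpace.ofCore (Hardy.normedSpaceCore k a)

/-- The orthogonal sum `H²₋(ζ₁, a) ⊕ H²₋(ζ₂, a) ⊕ H²₋(ζ₃, a)`. -/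
abbrev HardySum (a : ℝ) : Type := PiLp 2 (fun k : Fin 3 => Hardy k a)

/-- `g` is the value, on the line `{ζ_k (μ + is) : μ ∈ ℝ}`, of the function `F` given on the lines
`{ζ_k (μ + iν) : μ ∈ ℝ}` with `ν < s`: `g` is square integrable and is the limit as `ν ↑ s`, both
in `L²` and almost everywhere, of the restrictions of `F` to these lines. -/
def HasLineValue (k : Fin 3) (F : ℂ → ℂ) (s : ℝ) (g : ℝ → ℂ) : Prop :=
  MemLp g 2 volume ∧
  Tendsto (fun ν : ℝ => eLpNorm (fun μ => slice k F ν μ - g μ) 2 volume) (𝓝[<] s) (𝓝 0) ∧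
  ∀ᵐ μ : ℝ, Tendsto (fun ν : ℝ => slice k F ν μ) (𝓝[<] s) (𝓝 (g μ))

end

end RayBundle

/-! Everything reduces to one real variable. Extend the component of `f` on the `k`-th ray by zero
to a function `φ` on the line; its transform at `z` is `laplaceFourier φ (ζ_k z)`. Since `ζ_k` and
`zeta (conjIdx k)` are mutually inverse, `ζ_k z` has imaginary part below `a` exactly when `z` lies
in the half-plane of index `conjIdx k`; this is the source of the exchange of the second and third
transforms.

For `φ` vanishing on `x ≤ 0` with `e^{ax} φ` in `L²`, the identity `e^{νx} φ = e^{-(a-ν)|x|} e^{ax}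
φ` governs the direct part. Cauchy–Schwarz gives absolute convergence for `ν < a`, differentiation
under the integral gives holomorphy, and Plancherel gives the norm `√(2π) ‖e^{νx} φ‖` on each
horizontal line. The supremum over `ν < a` is `√(2π) ‖e^{ax} φ‖`, which is the norm identity
(`norm_hardyOfLaplace`).

Surjectivity is the Paley–Wiener theorem (`exists_eq_laplaceFourier`). Each horizontal restriction
of a Hardy function is the Plancherel transform of some `h_ν`; shifting the line of integration
shows that `e^{-νx} h_ν` does not depend on `ν`. The uniform bound as `ν → -∞` makes this common
function vanish for `x < 0`, and Fatou's lemma as `ν ↑ a` puts it in the weighted space.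

The value on a line `Im η = s`, `s ≤ a`, is the Plancherel transform of `e^{sx} φ`. Convergence in
`L²`, for approach from below and for truncations alike, is dominated convergence followed by
Plancherel. Convergence almost everywhere holds because the restriction to a lower line is a Poisson
integral of the value, which converges at every Lebesgue point. The case `s = a` gives the boundary
of the triangle, and `s = 0` the embedding into `L²(L)`. -/

namespace RayBundle

open scoped FourierTransform ComplexConjugate

/-! ### The Fourier–Laplace transform on the line and Plancherel's theorem -/

/-- The Fourier–Laplace transform `∫ e^{-iηx} φ(x) dx`. -/
noncomputable def laplaceFourier (φ : ℝ → ℂ) (η : ℂ) : ℂ :=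
  ∫ x : ℝ, Complex.exp (-Complex.I * η * x) * φ x

/-- The `L²` Fourier transform, with the normalisation of `laplaceFourier`. -/
noncomputable def planch (h : Lp ℂ 2 (volume : Measure ℝ)) (μ : ℝ) : ℂ :=
  (𝓕 h : Lp ℂ 2 (volume : Measure ℝ)) ((2 * Real.pi)⁻¹ * μ)

theorem quasiMeasurePreserving_mul_left {c : ℝ} (hc : c ≠ 0) :
    Measure.QuasiMeasurePreserving (fun x : ℝ => c * x) volume volume := by
  refine ⟨by fun_prop, ?_⟩
  rw [Real.map_volume_mul_left hc]
  exact Measure.smul_absolutelyContinuous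

theorem eLpNorm_comp_mul_left {c : ℝ} (hc : c ≠ 0) {g : ℝ → ℂ}
    (hg : AEStronglyMeasurable g volume) :
    eLpNorm (fun x => g (c * x)) 2 volume =
      ENNReal.ofReal (√|c⁻¹|) * eLpNorm g 2 volume := by
  have h1 := eLpNorm_map_measure (μ := (volume : Measure ℝ)) (p := 2) (f := fun x : ℝ => c * x)
    (g := g) (hg.mono_ac (quasiMeasurePreserving_mul_left hc).2)
    (by fun_prop)
  rw [Real.map_volume_mul_left hc, eLpNorm_smul_measure_of_ne_top (by norm_num)] at h1
  change eLpNorm (g ∘ fun x : ℝ => c * x) 2 volume = _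
  rw [← h1, smul_eq_mul, ENNReal.ofReal_rpow_of_nonneg (abs_nonneg _) (by norm_num),
    Real.sqrt_eq_rpow]
  norm_num

theorem two_pi_inv_ne_zero : (2 * Real.pi)⁻¹ ≠ 0 := by positivity

theorem memLp_planch (h : Lp ℂ 2 (volume : Measure ℝ)) : MemLp (planch h) 2 volume := by
  have hg := Lp.memLp (𝓕 h : Lp ℂ 2 (volume : Measure ℝ))
  refine ⟨hg.1.comp_quasiMeasurePreserving (quasiMeasurePreserving_mul_left two_pi_inv_ne_zero), ?_⟩
  have := eLpNorm_comp_mul_left two_pi_inv_ne_zero hg.1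
  unfold planch
  rw [this]
  exact ENNReal.mul_lt_top ENNReal.ofReal_lt_top hg.2

theorem eLpNorm_planch (h : Lp ℂ 2 (volume : Measure ℝ)) :
    eLpNorm (planch h) 2 volume = ENNReal.ofReal (√(2 * Real.pi)) * eLpNorm h 2 volume := by
  have hg := Lp.memLp (𝓕 h : Lp ℂ 2 (volume : Measure ℝ))
  have := eLpNorm_comp_mul_left two_pi_inv_ne_zero hg.1
  unfold planch
  rw [this, inv_inv, abs_of_pos (by positivity)]
  congr 1
  rw [← Lp.enorm_def, ← Lp.enorm_def, ← ofReal_norm, ← ofReal_norm, Lp.norm_fourier_eq]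

theorem planch_sub (h h' : Lp ℂ 2 (volume : Measure ℝ)) :
    planch (h - h') =ᵐ[volume] fun μ => planch h μ - planch h' μ := by
  have h1 := Lp.coeFn_sub (𝓕 h : Lp ℂ 2 (volume : Measure ℝ)) (𝓕 h')
  have h2 : (𝓕 (h - h') : Lp ℂ 2 (volume : Measure ℝ)) = 𝓕 h - 𝓕 h' :=
    (Lp.fourierTransformₗᵢ ℝ ℂ).map_sub h h'
  rw [← h2] at h1
  exact (quasiMeasurePreserving_mul_left two_pi_inv_ne_zero).ae h1

theorem exists_planch_eq {g : ℝ → ℂ} (hg : MemLp g 2 volume) :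
    ∃ h : Lp ℂ 2 (volume : Measure ℝ), planch h =ᵐ[volume] g := by
  have hpi : (2 * Real.pi) ≠ 0 := by positivity
  have hG : MemLp (fun x => g ((2 * Real.pi) * x)) 2 volume := by
    refine ⟨hg.1.comp_quasiMeasurePreserving (quasiMeasurePreserving_mul_left hpi), ?_⟩
    rw [eLpNorm_comp_mul_left hpi hg.1]
    exact ENNReal.mul_lt_top ENNReal.ofReal_lt_top hg.2
  refine ⟨𝓕⁻ (hG.toLp _), ?_⟩
  have h2 : (𝓕 (𝓕⁻ (hG.toLp _) : Lp ℂ 2 (volume : Measure ℝ)) : Lp ℂ 2 (volume : Measure ℝ)) =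
    hG.toLp _ := FourierTransform.fourier_fourierInv_eq _
  have h1 := (quasiMeasurePreserving_mul_left two_pi_inv_ne_zero).ae hG.coeFn_toLp
  filter_upwards [h1] with μ hμ
  unfold planch
  rw [h2, hμ, mul_inv_cancel_left₀ hpi]

theorem integral_conj_planch_mul (h h' : Lp ℂ 2 (volume : Measure ℝ)) :
    ∫ μ, conj (planch h μ) * planch h' μ = (2 * Real.pi : ℝ) * ∫ x, conj (h x) * h' x := by
  have h1 := Measure.integral_comp_mul_left (fun x => conj ((𝓕 h : Lp ℂ 2 (volume : Measure ℝ)) x)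
    * (𝓕 h' : Lp ℂ 2 (volume : Measure ℝ)) x) (2 * Real.pi)⁻¹
  have h2 := Lp.inner_fourier_eq h h'
  rw [L2.inner_def, L2.inner_def] at h2
  simp only [RCLike.inner_apply, mul_comm _ (conj _)] at h2
  unfold planch
  rw [h1, ← h2, inv_inv, abs_of_pos (by positivity), Complex.real_smul]

theorem laplaceFourier_ofReal (φ : ℝ → ℂ) (μ : ℝ) :
    laplaceFourier φ μ = 𝓕 φ ((2 * Real.pi)⁻¹ * μ) := by
  rw [Real.fourier_real_eq_integral_exp_smul]
  unfold laplaceFourier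
  refine integral_congr_ae (ae_of_all _ fun x => ?_)
  simp only [smul_eq_mul]
  congr 2
  have : (Real.pi : ℂ) ≠ 0 := by exact_mod_cast Real.pi_ne_zero
  push_cast
  field_simp

/-- The `L²` transform agrees with the transform of tempered distributions. Against a test function,
Fubini moves the integral transform onto the test function in the same way, so both sides define the
same distribution. -/
theorem fourier_ae_eq_of_integrable (h : Lp ℂ 2 (volume : Measure ℝ)) (hi : Integrable h volume) :
    (𝓕 h : Lp ℂ 2 (volume : Measure ℝ)) =ᵐ[volume] 𝓕 (h : ℝ → ℂ) := by
  refine ae_eq_of_integral_contDiff_smul_eq ((Lp.memLp _).locallyIntegrable (by norm_num))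
    (Continuous.locallyIntegrable (VectorFourier.fourierIntegral_continuous
      Real.continuous_fourierChar (L := innerₗ ℝ) (by fun_prop) hi)) fun g hg hgc => ?_
  have hgc' : HasCompactSupport (fun x => (g x : ℂ)) := hgc.comp_left Complex.ofReal_zero
  let ψ := hgc'.toSchwartzMap (Complex.ofRealCLM.contDiff.comp hg)
  have h1 := congrArg (fun T => T ψ) (Lp.fourier_toTemperedDistribution_eq h)
  simp only [TemperedDistribution.fourier_apply, Lp.toTemperedDistribution_apply] at h1
  have h2 : ∫ x, (𝓕 (ψ : ℝ → ℂ)) x • h x = ∫ x, ψ x • 𝓕 (h : ℝ → ℂ) x := by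
    simpa using! VectorFourier.integral_fourierIntegral_smul_eq_flip (L := innerₗ ℝ)
      Real.continuous_fourierChar (by fun_prop) (ψ.integrable (μ := volume)) hi
  simp only [SchwartzMap.fourier_coe] at h1
  exact h1.symm.trans h2

theorem planch_ae_eq {φ : ℝ → ℂ} (hφ : MemLp φ 2 volume) (hi : Integrable φ volume) :
    planch (hφ.toLp φ) =ᵐ[volume] fun μ => laplaceFourier φ μ := by
  have h0 := hφ.coeFn_toLp
  have h1 := fourier_ae_eq_of_integrable (hφ.toLp φ) (hi.congr h0.symm)
  have h2 := (quasiMeasurePreserving_mul_left two_pi_inv_ne_zero).ae h1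
  filter_upwards [h2] with μ hμ
  rw [laplaceFourier_ofReal, planch, hμ, Real.fourier_real_eq, Real.fourier_real_eq]
  refine integral_congr_ae ?_
  filter_upwards [h0] with x hx
  rw [hx]

/-! ### Almost everywhere convergence of Poisson integrals -/

/-- The Poisson kernel of the half-plane, with total mass `π`. -/
noncomputable def poisson (ε t : ℝ) : ℝ := ε / (ε ^ 2 + t ^ 2)

theorem continuous_poisson {ε : ℝ} (hε : 0 < ε) : Continuous (poisson ε) := by
  unfold poisson
  exact continuous_const.div (by fun_prop) fun t => by positivity

theorem poisson_nonneg {ε : ℝ} (hε : 0 < ε) (t : ℝ) : 0 ≤ poisson ε t := by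
  unfold poisson; positivity

theorem poisson_eq {ε : ℝ} (hε : 0 < ε) (t : ℝ) :
    poisson ε t = ε⁻¹ * (1 + (ε⁻¹ * t) ^ 2)⁻¹ := by
  unfold poisson; field_simp

theorem integrable_poisson {ε : ℝ} (hε : 0 < ε) (x : ℝ) :
    Integrable (fun t => poisson ε (t - x)) volume := by
  have h : Integrable (poisson ε) volume := by
    simp only [funext (poisson_eq hε)]
    exact (integrable_inv_one_add_sq.comp_mul_left' (inv_pos.2 hε).ne').const_mul _
  exact h.comp_sub_right x

theorem integral_poisson {ε : ℝ} (hε : 0 < ε) (x : ℝ) :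
    ∫ t, poisson ε (t - x) = Real.pi := by
  rw [integral_sub_right_eq_self (poisson ε) x]
  simp only [poisson_eq hε]
  rw [integral_const_mul, Measure.integral_comp_mul_left (fun t : ℝ => (1 + t ^ 2)⁻¹),
    integral_univ_inv_one_add_sq, inv_inv, abs_of_pos hε, smul_eq_mul, inv_mul_cancel_left₀ hε.ne']

theorem poisson_le_inv {ε : ℝ} (hε : 0 < ε) (t : ℝ) : poisson ε t ≤ ε⁻¹ := by
  rw [poisson_eq hε]
  exact mul_le_of_le_one_right (inv_pos.2 hε).le
    (inv_le_one_of_one_le₀ (by nlinarith [sq_nonneg (ε⁻¹ * t)]))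

theorem integrable_poisson_mul {ε : ℝ} (hε : 0 < ε) (x : ℝ) {g : ℝ → ℂ} (hg : MemLp g 2 volume) :
    Integrable (fun t => (poisson ε (t - x) : ℂ) * g t) volume := by
  have h2 : Integrable (fun t => ‖g t‖ ^ 2) volume := hg.integrable_norm_pow (by norm_num)
  refine ((integrable_poisson hε x).add (h2.const_mul ε⁻¹)).mono'
    ((Complex.continuous_ofReal.comp ((continuous_poisson hε).comp
      (continuous_id.sub continuous_const))).aestronglyMeasurable.mul hg.1) (ae_of_all _ fun t => ?_)
  have h0 := poisson_nonneg hε (t - x)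
  rw [norm_mul, Complex.norm_real, Real.norm_of_nonneg h0]
  change _ ≤ poisson ε (t - x) + ε⁻¹ * ‖g t‖ ^ 2
  have := poisson_le_inv hε (t - x)
  nlinarith [mul_nonneg h0 (sq_nonneg (‖g t‖ - 1)), mul_le_mul_of_nonneg_right this (sq_nonneg ‖g t‖),
    sq_nonneg ‖g t‖, mul_nonneg h0 (sq_nonneg (‖g t‖))]

/-- If one measure is dominated by another on all small balls around a point, then the same holds
for the integrals of the Poisson kernel over a small ball. -/
theorem setLIntegral_poisson_le {μ ν : Measure ℝ} {x δ ε : ℝ} (hε : 0 < ε)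
    (h : ∀ r, 0 < r → r ≤ δ → μ (Metric.ball x r) ≤ ν (Metric.ball x r)) :
    ∫⁻ t in Metric.ball x δ, ENNReal.ofReal (poisson ε (t - x)) ∂μ ≤
      ∫⁻ t in Metric.ball x δ, ENNReal.ofReal (poisson ε (t - x)) ∂ν := by
  have hc : Continuous fun t => poisson ε (t - x) :=
    (continuous_poisson hε).comp (continuous_id.sub continuous_const)
  -- Layer-cake formula: the superlevel sets of the kernel are balls centred at `x`, so only the
  -- measures of such balls enter. For `s ≥ 1/ε` the real square root is `0` and the ball is empty.
  have key (ρ : Measure ℝ) : ∫⁻ t in Metric.ball x δ, ENNReal.ofReal (poisson ε (t - x)) ∂ρ =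
      ∫⁻ s in Ioi (0 : ℝ), ρ (Metric.ball x (min δ (√(ε / s - ε ^ 2)))) := by
    rw [lintegral_eq_lintegral_meas_lt _ (ae_of_all _ fun t => poisson_nonneg hε _)
      hc.aemeasurable]
    refine setLIntegral_congr_fun measurableSet_Ioi fun s hs => ?_
    have hs : 0 < s := hs
    change (ρ.restrict (Metric.ball x δ)) {t | s < poisson ε (t - x)} = _
    rw [Measure.restrict_apply (measurableSet_lt measurable_const hc.measurable)]
    congr 1
    ext t
    have : s < poisson ε (t - x) ↔ |t - x| < √(ε / s - ε ^ 2) := by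
      rw [Real.lt_sqrt (abs_nonneg _), sq_abs, lt_sub_iff_add_lt, add_comm, poisson,
        lt_div_iff₀ hs, lt_div_iff₀ (by positivity), mul_comm]
    simp only [mem_inter_iff, mem_ofPred_eq, this, Metric.mem_ball, Real.dist_eq, lt_min_iff]
    tauto
  rw [key, key]
  refine lintegral_mono fun s => ?_
  rcases lt_or_ge 0 (min δ (√(ε / s - ε ^ 2))) with h0 | h0
  · exact h _ h0 (min_le_left _ _)
  · simp [Metric.ball_eq_empty.2 h0]

/-- The Lebesgue point property, in the form needed by `setLIntegral_poisson_le`: near `x` the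
measure `|g - g x| dt` is dominated on balls by a small multiple of Lebesgue measure. -/
theorem ae_forall_lintegral_ball_le {g : ℝ → ℂ} (hg : LocallyIntegrable g volume) :
    ∀ᵐ x : ℝ, ∀ η : ℝ≥0, 0 < η → ∃ δ > 0, ∀ r, 0 < r → r ≤ δ →
      ∫⁻ t in Metric.ball x r, ‖g t - g x‖ₑ ≤ η * volume (Metric.ball x r) := by
  filter_upwards [IsUnifLocDoublingMeasure.ae_tendsto_average_norm_sub volume hg 1] with x hx η hη
  have h1 := hx (l := 𝓝[>] (0 : ℝ)) (fun _ => x) id tendsto_id (by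
    filter_upwards [self_mem_nhdsWithin] with r hr
    simpa using (le_of_lt hr))
  have h2 := h1.eventually (gt_mem_nhds (show (0 : ℝ) < η from hη))
  obtain ⟨δ, hδ, h3⟩ := (mem_nhdsGT_iff_exists_Ioc_subset).1 h2
  refine ⟨δ, hδ, fun r hr hrδ => ?_⟩
  have h4 : ⨍ y in Metric.closedBall x r, ‖g y - g x‖ < η := h3 ⟨hr, hrδ⟩
  have hi : IntegrableOn (fun y => ‖g y - g x‖) (Metric.closedBall x r) volume :=
    ((hg.integrableOn_isCompact (isCompact_closedBall x r)).sub
      (integrableOn_const (measure_closedBall_lt_top.ne))).norm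
  have h2r : (0 : ℝ) < 2 * r := by positivity
  rw [setAverage_eq, smul_eq_mul, Measure.real, Real.volume_closedBall,
    ENNReal.toReal_ofReal h2r.le, inv_mul_lt_iff₀ h2r] at h4
  calc ∫⁻ t in Metric.ball x r, ‖g t - g x‖ₑ
      ≤ ∫⁻ t in Metric.closedBall x r, ‖g t - g x‖ₑ :=
        lintegral_mono_set Metric.ball_subset_closedBall
    _ = ENNReal.ofReal (∫ t in Metric.closedBall x r, ‖g t - g x‖) := by
        rw [ofReal_integral_eq_lintegral_ofReal hi (ae_of_all _ fun _ => norm_nonneg _)]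
        simp only [ofReal_norm]
    _ ≤ ENNReal.ofReal (2 * r * η) := ENNReal.ofReal_le_ofReal h4.le
    _ = η * volume (Metric.ball x r) := by
        rw [Real.volume_ball, mul_comm, ENNReal.ofReal_mul η.coe_nonneg, ENNReal.ofReal_coe_nnreal]

/-- For `|t| ≥ δ` one has `1 + t² ≤ (1 + δ⁻²) t²`. Hence the tail of the kernel is `O(ε)` times the
fixed kernel of width `1`, against which `|g - g x|` is integrable. -/
theorem poisson_le_of_le_abs {ε δ t : ℝ} (hε : 0 < ε) (hδ : 0 < δ) (ht : δ ≤ |t|) :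
    poisson ε t ≤ ε * (1 + (δ ^ 2)⁻¹) * poisson 1 t := by
  have h1 : δ ^ 2 ≤ t ^ 2 := by rw [← sq_abs t]; gcongr
  have h2 : 0 < t ^ 2 := lt_of_lt_of_le (by positivity) h1
  have h3 : 1 ≤ (δ ^ 2)⁻¹ * t ^ 2 := by
    rw [inv_mul_eq_div, le_div_iff₀ (by positivity)]; linarith
  unfold poisson
  rw [mul_one_div, div_le_div_iff₀ (by positivity) (by positivity), mul_assoc]
  refine mul_le_mul_of_nonneg_left ?_ hε.le
  have : 0 < (δ ^ 2)⁻¹ * ε ^ 2 := by positivity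
  nlinarith [sq_nonneg ε]

theorem ae_tendsto_integral_poisson_mul {g : ℝ → ℂ} (hg : MemLp g 2 volume) :
    ∀ᵐ x : ℝ, Tendsto (fun ε => ∫ t, (poisson ε (t - x) : ℂ) * g t) (𝓝[>] 0)
      (𝓝 (Real.pi * g x)) := by
  filter_upwards [ae_forall_lintegral_ball_le (hg.locallyIntegrable (by norm_num))] with x hx
  have hd (ε : ℝ) (hε : 0 < ε) :
      Integrable (fun t => (poisson ε (t - x) : ℂ) * (g t - g x)) volume := by
    simp only [mul_sub]
    exact (integrable_poisson_mul hε x hg).sub ((integrable_poisson hε x).ofReal.mul_const _)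
  have hdiff (ε : ℝ) (hε : 0 < ε) : (∫ t, (poisson ε (t - x) : ℂ) * g t) - Real.pi * g x =
      ∫ t, (poisson ε (t - x) : ℂ) * (g t - g x) := by
    have : (Real.pi : ℂ) * g x = ∫ t, (poisson ε (t - x) : ℂ) * g x := by
      rw [integral_mul_const, integral_complex_ofReal, integral_poisson hε]
    simp only [this, mul_sub]
    exact (integral_sub (integrable_poisson_mul hε x hg)
      ((integrable_poisson hε x).ofReal.mul_const _)).symm
  have henorm (ε : ℝ) (hε : 0 < ε) (t : ℝ) : ‖(poisson ε (t - x) : ℂ) * (g t - g x)‖ₑ =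
      ENNReal.ofReal (poisson ε (t - x)) * ‖g t - g x‖ₑ := by
    rw [enorm_mul, ← ofReal_norm (poisson ε (t - x) : ℂ), Complex.norm_real,
      Real.norm_of_nonneg (poisson_nonneg hε _)]
  set M : ℝ≥0∞ := ∫⁻ t, ENNReal.ofReal (poisson 1 (t - x)) * ‖g t - g x‖ₑ with hM
  have hMtop : M ≠ ∞ := by
    have := (hd 1 one_pos).2
    simp only [HasFiniteIntegral, henorm 1 one_pos] at this
    exact this.ne
  have hmeas : AEMeasurable (fun t => ‖g t - g x‖ₑ) volume :=
    (hg.1.sub aestronglyMeasurable_const).enorm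
  have hcont (ε : ℝ) (hε : 0 < ε) : Continuous fun t => poisson ε (t - x) :=
    (continuous_poisson hε).comp (continuous_id.sub continuous_const)
  -- Split at distance `δ`: the near part is at most `η` times the total mass `π` of the kernel, the
  -- far part is `O(ε)` for fixed `δ`.
  have main (η : ℝ≥0) (hη : 0 < η) : ∃ δ > 0, ∀ ε > 0,
      ‖(∫ t, (poisson ε (t - x) : ℂ) * g t) - Real.pi * g x‖ₑ ≤
        η * ENNReal.ofReal Real.pi + ENNReal.ofReal (ε * (1 + (δ ^ 2)⁻¹)) * M := by
    obtain ⟨δ, hδ, h⟩ := hx η hη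
    refine ⟨δ, hδ, fun ε hε => ?_⟩
    rw [hdiff ε hε]
    refine (enorm_integral_le_lintegral_enorm _).trans ?_
    simp only [henorm ε hε]
    rw [← lintegral_add_compl _ (measurableSet_ball (x := x) (ε := δ))]
    refine add_le_add ?_ ?_
    · have h1 := setLIntegral_poisson_le (x := x) (δ := δ) (ε := ε)
        (μ := volume.withDensity fun t => ‖g t - g x‖ₑ) (ν := (η : ℝ≥0∞) • volume) hε
        fun r hr hrδ => by
          rw [withDensity_apply _ measurableSet_ball, Measure.smul_apply, smul_eq_mul]
          exact h r hr hrδ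
      rw [restrict_withDensity measurableSet_ball, lintegral_withDensity_eq_lintegral_mul₀
        hmeas.restrict (hcont ε hε).measurable.ennreal_ofReal.aemeasurable,
        Measure.restrict_smul, lintegral_smul_measure] at h1
      simp only [Pi.mul_apply, mul_comm (‖_‖ₑ), smul_eq_mul] at h1
      refine h1.trans (mul_le_mul_right ?_ _)
      refine (setLIntegral_le_lintegral _ _).trans ?_
      rw [← ofReal_integral_eq_lintegral_ofReal (integrable_poisson hε x)
        (ae_of_all _ fun t => poisson_nonneg hε _), integral_poisson hε]
    · rw [hM, ← lintegral_const_mul' _ _ ENNReal.ofReal_ne_top]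
      refine le_trans (setLIntegral_mono' measurableSet_ball.compl fun t ht => ?_)
        (setLIntegral_le_lintegral _ _)
      rw [← mul_assoc, ← ENNReal.ofReal_mul (by positivity)]
      gcongr
      refine poisson_le_of_le_abs hε hδ ?_
      simpa [Real.dist_eq] using ht
  rw [tendsto_iff_edist_tendsto_0, ENNReal.tendsto_nhds_zero]
  intro e he
  obtain ⟨e', he', hee⟩ : ∃ e' : ℝ≥0, 0 < e' ∧ (e' : ℝ≥0∞) < e := by
    obtain ⟨q, h0, h1⟩ := ENNReal.lt_iff_exists_nnreal_btwn.1 he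
    exact ⟨q, by exact_mod_cast h0, h1⟩
  have hpi : 0 < Real.toNNReal Real.pi := Real.toNNReal_pos.2 Real.pi_pos
  -- Dividing by `π` makes the near part contribute exactly `e' / 2`.
  obtain ⟨δ, hδ, h⟩ := main (e' / 2 / Real.toNNReal Real.pi) (by positivity)
  have ht : Tendsto (fun ε : ℝ => ENNReal.ofReal (ε * (1 + (δ ^ 2)⁻¹)) * M) (𝓝[>] 0) (𝓝 0) := by
    have h1 : Tendsto (fun ε : ℝ => ENNReal.ofReal (ε * (1 + (δ ^ 2)⁻¹))) (𝓝[>] 0) (𝓝 0) := by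
      have : Continuous fun ε : ℝ => ENNReal.ofReal (ε * (1 + (δ ^ 2)⁻¹)) :=
        ENNReal.continuous_ofReal.comp (by fun_prop)
      simpa using this.continuousWithinAt (s := Ioi 0) (x := 0) |>.tendsto
    simpa using ENNReal.Tendsto.mul_const h1 (Or.inr hMtop)
  filter_upwards [self_mem_nhdsWithin, ht.eventually (gt_mem_nhds
    (show (0 : ℝ≥0∞) < ((e' / 2 : ℝ≥0) : ℝ≥0∞) from ENNReal.coe_pos.2 (half_pos he')))]
    with ε hε h2
  rw [edist_eq_enorm_sub]
  refine (h ε hε).trans (le_trans (add_le_add_right h2.le _) ?_)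
  rw [ENNReal.ofReal, ← ENNReal.coe_mul, div_mul_cancel₀ _ hpi.ne', ← ENNReal.coe_add, add_halves]
  exact hee.le

/-! ### The Fourier–Laplace transform of weighted `L²` functions -/

/-- The function `e^{νx} φ(x)`. -/
noncomputable def expMul (ν : ℝ) (φ : ℝ → ℂ) (x : ℝ) : ℂ := (Real.exp (ν * x) : ℂ) * φ x

theorem expMul_expMul (ν ν' : ℝ) (φ : ℝ → ℂ) : expMul ν (expMul ν' φ) = expMul (ν + ν') φ := by
  funext x
  simp only [expMul, add_mul, Real.exp_add]
  push_cast
  ring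

theorem expMul_zero (φ : ℝ → ℂ) : expMul 0 φ = φ := by
  funext x
  simp [expMul]

theorem norm_expMul (ν : ℝ) (φ : ℝ → ℂ) (x : ℝ) : ‖expMul ν φ x‖ = Real.exp (ν * x) * ‖φ x‖ := by
  rw [expMul, norm_mul, Complex.norm_real, Real.norm_of_nonneg (Real.exp_pos _).le]

theorem aestronglyMeasurable_expMul {ν ν' : ℝ} {φ : ℝ → ℂ} {ρ : Measure ℝ}
    (h : AEStronglyMeasurable (expMul ν φ) ρ) : AEStronglyMeasurable (expMul ν' φ) ρ := by
  have : expMul ν' φ = expMul (ν' - ν) (expMul ν φ) := by rw [expMul_expMul]; congr 1; ring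
  rw [this]
  exact (Continuous.aestronglyMeasurable (by fun_prop)).mul h

theorem exp_mul_eq_expMul (φ : ℝ → ℂ) (μ ν x : ℝ) :
    Complex.exp (-Complex.I * (μ + ν * Complex.I) * x) * φ x =
      Complex.exp (-Complex.I * μ * x) * expMul ν φ x := by
  have : -Complex.I * (μ + ν * Complex.I) * x = -Complex.I * μ * x + ((ν * x : ℝ) : ℂ) := by
    push_cast
    linear_combination (-(ν : ℂ) * x) * Complex.I_mul_I
  rw [this, Complex.exp_add, expMul, Complex.ofReal_exp, mul_assoc]

theorem laplaceFourier_add_mul_I (φ : ℝ → ℂ) (μ ν : ℝ) :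
    laplaceFourier φ (μ + ν * Complex.I) = laplaceFourier (expMul ν φ) μ := by
  simp only [laplaceFourier, exp_mul_eq_expMul]

theorem norm_exp_mul (η : ℂ) (x : ℝ) : ‖Complex.exp (-Complex.I * η * x)‖ = Real.exp (η.im * x) := by
  rw [Complex.norm_exp]
  simp

theorem integrable_exp_mul {φ : ℝ → ℂ} {η : ℂ} {ρ : Measure ℝ} (h : Integrable (expMul η.im φ) ρ) :
    Integrable (fun x : ℝ => Complex.exp (-Complex.I * η * x) * φ x) ρ := by
  refine h.congr' ?_ (ae_of_all _ fun x => ?_)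
  · have h0 := aestronglyMeasurable_expMul (ν' := 0) h.1
    rw [expMul_zero] at h0
    exact (Continuous.aestronglyMeasurable (by fun_prop)).mul h0
  · rw [norm_expMul, norm_mul, norm_exp_mul]

/-- Nothing is assumed about the support of `φ`: the weight `η.im + r` controls `x ≥ 0` and the
weight `η.im - r` controls `x ≤ 0`. -/
theorem differentiableAt_laplaceFourier {φ : ℝ → ℂ} {η : ℂ} {r : ℝ} (hr : 0 < r)
    (h1 : Integrable (expMul (η.im + r) φ) volume) (h2 : Integrable (expMul (η.im - r) φ) volume) :
    DifferentiableAt ℂ (laplaceFourier φ) η := by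
  -- One half of `r` is the radius of the ball in which `z` moves; the other half absorbs the factor
  -- `|x|` produced by differentiation.
  set δ := r / 2 with hδ
  have hδ0 : 0 < δ := by positivity
  have hexp (ν x : ℝ) (hν : |ν - η.im| ≤ δ) :
      (1 + |x|) * Real.exp (ν * x) ≤
        (1 + δ⁻¹) * (Real.exp ((η.im + r) * x) + Real.exp ((η.im - r) * x)) := by
    have e1 : δ * |x| + 1 ≤ Real.exp (δ * |x|) := Real.add_one_le_exp _
    have e2 : 1 + |x| ≤ (1 + δ⁻¹) * Real.exp (δ * |x|) := by
      have : |x| = δ⁻¹ * (δ * |x|) := by field_simp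
      have h3 : δ⁻¹ * (δ * |x|) ≤ δ⁻¹ * Real.exp (δ * |x|) := by gcongr; linarith
      have h4 : 1 ≤ Real.exp (δ * |x|) := Real.one_le_exp (by positivity)
      linarith
    have e3 : ν * x ≤ η.im * x + δ * |x| := by
      have : (ν - η.im) * x ≤ δ * |x| := by
        calc (ν - η.im) * x ≤ |(ν - η.im) * x| := le_abs_self _
          _ = |ν - η.im| * |x| := abs_mul _ _
          _ ≤ δ * |x| := by gcongr
      linarith
    have e4 : Real.exp (δ * |x|) * Real.exp (ν * x) ≤
        Real.exp ((η.im + r) * x) + Real.exp ((η.im - r) * x) := by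
      rw [← Real.exp_add]
      rcases le_total 0 x with hx | hx
      · rw [abs_of_nonneg hx] at *
        refine le_trans (Real.exp_le_exp.2 ?_) (le_add_of_nonneg_right (Real.exp_pos _).le)
        rw [hδ] at *; linarith
      · rw [abs_of_nonpos hx] at *
        refine le_trans (Real.exp_le_exp.2 ?_) (le_add_of_nonneg_left (Real.exp_pos _).le)
        rw [hδ] at *; linarith
    calc (1 + |x|) * Real.exp (ν * x) ≤ (1 + δ⁻¹) * Real.exp (δ * |x|) * Real.exp (ν * x) := by gcongr
      _ = (1 + δ⁻¹) * (Real.exp (δ * |x|) * Real.exp (ν * x)) := by ring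
      _ ≤ _ := by gcongr
  have hφ : AEStronglyMeasurable φ volume := by
    have h0 := aestronglyMeasurable_expMul (ν' := 0) h1.1
    rwa [expMul_zero] at h0
  set bound : ℝ → ℝ := fun x =>
    (1 + δ⁻¹) * (‖expMul (η.im + r) φ x‖ + ‖expMul (η.im - r) φ x‖) with hbound
  have hbi : Integrable bound volume := (h1.norm.add h2.norm).const_mul _
  have hb (z : ℂ) (hz : z ∈ Metric.ball η δ) (x : ℝ) :
      (1 + |x|) * (Real.exp (z.im * x) * ‖φ x‖) ≤ bound x := by
    have : |z.im - η.im| ≤ δ := by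
      rw [← Complex.sub_im]
      exact (Complex.abs_im_le_norm _).trans (by simpa [dist_eq_norm] using (Metric.mem_ball.1 hz).le)
    simp only [hbound, norm_expMul]
    nlinarith [mul_le_mul_of_nonneg_right (hexp _ x this) (norm_nonneg (φ x))]
  refine (hasDerivAt_integral_of_dominated_loc_of_deriv_le (𝕜 := ℂ)
    (F := fun (z : ℂ) (x : ℝ) => Complex.exp (-Complex.I * z * x) * φ x)
    (F' := fun (z : ℂ) (x : ℝ) => Complex.exp (-Complex.I * z * x) * (-Complex.I * x) * φ x)
    (bound := bound) (Metric.ball_mem_nhds η hδ0) (Eventually.of_forall fun z =>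
      (Continuous.aestronglyMeasurable (by fun_prop)).mul hφ) ?_
    ((Continuous.aestronglyMeasurable (by fun_prop)).mul hφ) ?_ hbi ?_).2.differentiableAt
  · refine hbi.mono' ((Continuous.aestronglyMeasurable (by fun_prop)).mul hφ) (ae_of_all _ fun x => ?_)
    refine le_trans ?_ (hb η (Metric.mem_ball_self hδ0) x)
    rw [norm_mul, norm_exp_mul]
    exact le_mul_of_one_le_left (by positivity) (by linarith [abs_nonneg x])
  · refine ae_of_all _ fun x z hz => le_trans ?_ (hb z hz x)
    rw [norm_mul, norm_mul, norm_exp_mul, norm_mul, norm_neg, Complex.norm_I, Complex.norm_real,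
      one_mul, Real.norm_eq_abs, mul_comm (Real.exp _), mul_assoc]
    gcongr
    linarith
  · refine ae_of_all _ fun x z _ => ?_
    have : HasDerivAt (fun z : ℂ => -Complex.I * z * x) (-Complex.I * x) z := by
      simpa using ((hasDerivAt_id z).const_mul (-Complex.I)).mul_const (x : ℂ)
    exact this.cexp.mul_const _

/-- The function `e^{iμx - ε|x|}`, whose Fourier transform is the Poisson kernel. -/
noncomputable def expKernel (ε μ x : ℝ) : ℂ := Complex.exp (Complex.I * μ * x - ε * |x|)

theorem continuous_expKernel (ε μ : ℝ) : Continuous (expKernel ε μ) := by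
  unfold expKernel
  exact Complex.continuous_exp.comp ((by fun_prop : Continuous fun x : ℝ => Complex.I * μ * x).sub
    (continuous_const.mul (Complex.continuous_ofReal.comp continuous_abs)))

theorem norm_expKernel (ε μ x : ℝ) : ‖expKernel ε μ x‖ = Real.exp (-ε * |x|) := by
  rw [expKernel, Complex.norm_exp]
  simp

theorem exp_mul_expKernel_of_nonneg (ε μ t : ℝ) {x : ℝ} (hx : 0 ≤ x) :
    Complex.exp (-Complex.I * t * x) * expKernel ε μ x =
      Complex.exp ((-ε - Complex.I * (t - μ)) * x) := by
  rw [expKernel, ← Complex.exp_add, abs_of_nonneg hx]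
  ring_nf

theorem exp_mul_expKernel_of_nonpos (ε μ t : ℝ) {x : ℝ} (hx : x ≤ 0) :
    Complex.exp (-Complex.I * t * x) * expKernel ε μ x =
      Complex.exp ((ε - Complex.I * (t - μ)) * x) := by
  rw [expKernel, ← Complex.exp_add, abs_of_nonpos hx]
  push_cast
  ring_nf

theorem integrableOn_exp_mul_expKernel_Iic {ε : ℝ} (hε : 0 < ε) (μ t : ℝ) :
    IntegrableOn (fun x : ℝ => Complex.exp (-Complex.I * t * x) * expKernel ε μ x) (Iic 0) volume :=
  (integrableOn_exp_mul_complex_Iic (a := ε - Complex.I * (t - μ)) (by simpa using hε) 0).congr_fun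
    (fun _ hx => (exp_mul_expKernel_of_nonpos ε μ t hx).symm) measurableSet_Iic

theorem integrableOn_exp_mul_expKernel_Ioi {ε : ℝ} (hε : 0 < ε) (μ t : ℝ) :
    IntegrableOn (fun x : ℝ => Complex.exp (-Complex.I * t * x) * expKernel ε μ x) (Ioi 0) volume :=
  (integrableOn_exp_mul_complex_Ioi (a := -ε - Complex.I * (t - μ)) (by simpa using hε) 0).congr_fun
    (fun _ hx => (exp_mul_expKernel_of_nonneg ε μ t (le_of_lt hx)).symm) measurableSet_Ioi

theorem integrable_expKernel {ε : ℝ} (hε : 0 < ε) (μ : ℝ) :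
    Integrable (expKernel ε μ) volume := by
  have h := (integrableOn_exp_mul_expKernel_Iic hε μ 0).union
    (integrableOn_exp_mul_expKernel_Ioi hε μ 0)
  rw [Iic_union_Ioi, integrableOn_univ] at h
  simpa using h

theorem memLp_expKernel {ε : ℝ} (hε : 0 < ε) (μ : ℝ) : MemLp (expKernel ε μ) 2 volume := by
  rw [memLp_two_iff_integrable_sq_norm (continuous_expKernel ε μ).aestronglyMeasurable]
  refine (integrable_expKernel (mul_pos two_pos hε) μ).norm.congr (ae_of_all _ fun x => ?_)
  simp only [norm_expKernel, sq, ← Real.exp_add]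
  ring_nf

theorem laplaceFourier_expKernel {ε : ℝ} (hε : 0 < ε) (μ t : ℝ) :
    laplaceFourier (expKernel ε μ) t = 2 * poisson ε (t - μ) := by
  unfold laplaceFourier
  rw [← intervalIntegral.integral_Iic_add_Ioi (integrableOn_exp_mul_expKernel_Iic hε μ t)
    (integrableOn_exp_mul_expKernel_Ioi hε μ t),
    setIntegral_congr_fun measurableSet_Iic fun x hx => exp_mul_expKernel_of_nonpos ε μ t hx,
    setIntegral_congr_fun measurableSet_Ioi fun x hx =>
      exp_mul_expKernel_of_nonneg ε μ t (le_of_lt hx),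
    integral_exp_mul_complex_Iic (by simpa using hε),
    integral_exp_mul_complex_Ioi (by simpa using hε)]
  have h1 : (ε : ℂ) - Complex.I * (t - μ) ≠ 0 := fun h => hε.ne' (by simpa using congrArg Complex.re h)
  have h2 : -(ε : ℂ) - Complex.I * (t - μ) ≠ 0 :=
    fun h => hε.ne' (by simpa using congrArg Complex.re h)
  have h3 : (ε : ℂ) ^ 2 + (t - μ) ^ 2 ≠ 0 := by
    have : ε ^ 2 + (t - μ) ^ 2 ≠ 0 := by positivity
    exact_mod_cast this
  unfold poisson
  push_cast
  simp only [mul_zero, Complex.exp_zero]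
  field_simp
  linear_combination (-2 * (ε : ℂ) * (t - μ) ^ 2) * Complex.I_sq

/-- The Abel means of a Fourier integral are the Poisson integrals of the `L²` transform. -/
theorem integral_poisson_mul_planch (h : Lp ℂ 2 (volume : Measure ℝ)) {ε : ℝ} (hε : 0 < ε) (μ : ℝ) :
    ∫ t, (poisson ε (t - μ) : ℂ) * planch h t =
      Real.pi * ∫ x, conj (expKernel ε μ x) * h x := by
  have h1 := integral_conj_planch_mul ((memLp_expKernel hε μ).toLp _) h
  have h2 := planch_ae_eq (memLp_expKernel hε μ) (integrable_expKernel hε μ)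
  have h3 : ∫ t, conj (planch ((memLp_expKernel hε μ).toLp _) t) * planch h t =
      2 * ∫ t, (poisson ε (t - μ) : ℂ) * planch h t := by
    rw [← integral_const_mul]
    refine integral_congr_ae ?_
    filter_upwards [h2] with t ht
    rw [ht, laplaceFourier_expKernel hε, map_mul, Complex.conj_ofReal, Complex.conj_ofNat]
    ring
  have h4 : ∫ x, conj ((memLp_expKernel hε μ).toLp _ x) * h x =
      ∫ x, conj (expKernel ε μ x) * h x := by
    refine integral_congr_ae ?_
    filter_upwards [(memLp_expKernel hε μ).coeFn_toLp] with x hx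
    rw [hx]
  rw [h3, h4] at h1
  push_cast at h1
  -- Parseval carries the factor `2π`, and the transform of `expKernel` is twice the Poisson kernel.
  linear_combination h1 / 2

/-- Dominated convergence with majorant `(2|h|)²`. Convergence of the multipliers is asked only
where `h ≠ 0`, because the truncations `(0, N]` never reach `x ≤ 0`. -/
theorem tendsto_eLpNorm_mul_sub {ι : Type*} {l : Filter ι} [l.IsCountablyGenerated] {h : ℝ → ℂ}
    (hh : MemLp h 2 volume) {m : ι → ℝ → ℂ} (hm : ∀ᶠ i in l, AEStronglyMeasurable (m i) volume)
    (hb : ∀ᶠ i in l, ∀ x, ‖m i x‖ ≤ 1)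
    (hl : ∀ x, h x ≠ 0 → Tendsto (fun i => m i x) l (𝓝 1)) :
    Tendsto (fun i => eLpNorm (fun x => m i x * h x - h x) 2 volume) l (𝓝 0) := by
  have key : Tendsto (fun i => ∫⁻ x, ‖m i x * h x - h x‖ₑ ^ (2 : ℝ)) l (𝓝 0) := by
    have := tendsto_lintegral_filter_of_dominated_convergence' (μ := volume) (l := l)
      (F := fun i x => ‖m i x * h x - h x‖ₑ ^ (2 : ℝ)) (f := fun _ => 0)
      (fun x => (2 * ‖h x‖ₑ) ^ (2 : ℝ))
      (by
        filter_upwards [hm] with i hi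
        exact ((hi.mul hh.1).sub hh.1).enorm.pow_const _)
      (by
        filter_upwards [hb] with i hi
        refine ae_of_all _ fun x => ENNReal.rpow_le_rpow ?_ (by norm_num)
        rw [two_mul]
        refine enorm_sub_le.trans (add_le_add_left ?_ _)
        rw [enorm_mul]
        refine mul_le_of_le_one_left (by positivity) ?_
        rw [← ofReal_norm, ENNReal.ofReal_le_one]
        exact hi x)
      (by
        simp only [ENNReal.mul_rpow_of_nonneg _ _ (show (0 : ℝ) ≤ 2 by norm_num)]
        rw [lintegral_const_mul' _ _ (by norm_num)]
        refine ENNReal.mul_ne_top (by norm_num) ?_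
        have := lintegral_rpow_enorm_lt_top_of_eLpNorm_lt_top (by norm_num) (by norm_num) hh.2
        simpa using this.ne)
      (ae_of_all _ fun x => by
        by_cases hx : h x = 0
        · simp [hx, tendsto_const_nhds]
        have h1 : Tendsto (fun i => m i x * h x - h x) l (𝓝 0) := by
          simpa using ((hl x hx).mul_const (h x)).sub_const (h x)
        have h2 := (ENNReal.continuous_rpow_const (y := 2)).tendsto _ |>.comp h1.enorm
        simpa [Function.comp_def] using h2)
    simpa using this
  have h3 := (ENNReal.continuous_rpow_const (y := (2 : ℝ)⁻¹)).tendsto _ |>.comp key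
  simp only [Function.comp_def, ENNReal.zero_rpow_of_pos (show (0 : ℝ) < 2⁻¹ by norm_num)] at h3
  refine h3.congr fun i => ?_
  rw [eLpNorm_eq_lintegral_rpow_enorm_toReal (by norm_num) (by norm_num)]
  simp

/-! ### Functions supported on the positive half-line -/

section HalfLine

variable {φ : ℝ → ℂ} {s : ℝ}

/-- On the support of `φ` one has `x = |x|`, so lowering the weight from `s` to `ν` is
multiplication by a decaying kernel bounded by `1`. Square integrability, integrability,
monotonicity of norms and the limit `ν ↑ s` all follow from this. -/
theorem expMul_eq_expKernel_mul (h0 : ∀ x ≤ 0, φ x = 0) (ν x : ℝ) :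
    expMul ν φ x = expKernel (s - ν) 0 x * expMul s φ x := by
  rcases le_or_gt x 0 with hx | hx
  · simp [expMul, h0 x hx]
  · rw [expMul, expMul, ← mul_assoc, expKernel, abs_of_pos hx, Complex.ofReal_exp,
      Complex.ofReal_exp, ← Complex.exp_add]
    congr 2
    push_cast
    ring

theorem norm_expKernel_le_one {ε : ℝ} (hε : 0 ≤ ε) (μ x : ℝ) : ‖expKernel ε μ x‖ ≤ 1 := by
  rw [norm_expKernel]
  exact Real.exp_le_one_iff.2 (by nlinarith [abs_nonneg x])

theorem memLp_expMul (h0 : ∀ x ≤ 0, φ x = 0) (h : MemLp (expMul s φ) 2 volume) {ν : ℝ} (hν : ν ≤ s) :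
    MemLp (expMul ν φ) 2 volume := by
  refine h.mono (aestronglyMeasurable_expMul h.1) (ae_of_all _ fun x => ?_)
  rw [expMul_eq_expKernel_mul (s := s) h0, norm_mul]
  exact mul_le_of_le_one_left (norm_nonneg _) (norm_expKernel_le_one (sub_nonneg.2 hν) _ _)

theorem integrable_expMul (h0 : ∀ x ≤ 0, φ x = 0) (h : MemLp (expMul s φ) 2 volume) {ν : ℝ}
    (hν : ν < s) : Integrable (expMul ν φ) volume := by
  rw [funext (expMul_eq_expKernel_mul (s := s) h0 ν)]
  exact (memLp_expKernel (sub_pos.2 hν) 0).integrable_mul h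

theorem differentiableAt_laplaceFourier_of_im_lt (h0 : ∀ x ≤ 0, φ x = 0)
    (h : MemLp (expMul s φ) 2 volume) {η : ℂ} (hη : η.im < s) :
    DifferentiableAt ℂ (laplaceFourier φ) η := by
  have hr : 0 < (s - η.im) / 2 := by linarith
  exact differentiableAt_laplaceFourier hr (integrable_expMul h0 h (by linarith))
    (integrable_expMul h0 h (by linarith))

theorem tendsto_expKernel (s x : ℝ) :
    Tendsto (fun ν : ℝ => expKernel (s - ν) 0 x) (𝓝[<] s) (𝓝 1) := by
  have : Continuous fun ν : ℝ => expKernel (s - ν) 0 x := by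
    unfold expKernel
    fun_prop
  simpa [expKernel] using (this.tendsto s).mono_left nhdsWithin_le_nhds

theorem eLpNorm_laplaceFourier (h0 : ∀ x ≤ 0, φ x = 0) (h : MemLp (expMul s φ) 2 volume) {ν : ℝ}
    (hν : ν < s) : eLpNorm (fun μ : ℝ => laplaceFourier φ (μ + ν * Complex.I)) 2 volume =
      ENNReal.ofReal (√(2 * Real.pi)) * eLpNorm (expMul ν φ) 2 volume := by
  have h1 := planch_ae_eq (memLp_expMul h0 h hν.le) (integrable_expMul h0 h hν)
  simp only [laplaceFourier_add_mul_I]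
  rw [← eLpNorm_congr_ae h1, eLpNorm_planch, eLpNorm_congr_ae (MemLp.coeFn_toLp _)]

/-- By Plancherel the two `L²` distances differ by the factor `√(2π)`. The family `u` is left
general to serve both the approach `ν ↑ s` and the truncations. -/
theorem tendsto_eLpNorm_planch_sub {ι : Type*} {l : Filter ι} (h : MemLp (expMul s φ) 2 volume)
    {u : ι → ℝ → ℂ} (hu2 : ∀ᶠ i in l, MemLp (u i) 2 volume)
    (hu1 : ∀ᶠ i in l, Integrable (u i) volume)
    (hlim : Tendsto (fun i => eLpNorm (fun x => u i x - expMul s φ x) 2 volume) l (𝓝 0)) :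
    Tendsto (fun i => eLpNorm (fun μ : ℝ => laplaceFourier (u i) μ - planch (h.toLp _) μ) 2 volume)
      l (𝓝 0) := by
  have h3 : Tendsto (fun i => ENNReal.ofReal (√(2 * Real.pi)) *
      eLpNorm (fun x => u i x - expMul s φ x) 2 volume) l (𝓝 0) := by
    have := ENNReal.Tendsto.const_mul (a := ENNReal.ofReal (√(2 * Real.pi))) hlim
      (Or.inr ENNReal.ofReal_ne_top)
    rwa [mul_zero] at this
  refine h3.congr' ?_
  filter_upwards [hu2, hu1] with i hi2 hi1
  have h4 : (fun μ : ℝ => laplaceFourier (u i) μ - planch (h.toLp _) μ) =ᵐ[volume]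
      planch (hi2.toLp _ - h.toLp _) := by
    filter_upwards [planch_sub (hi2.toLp _) (h.toLp _), planch_ae_eq hi2 hi1] with μ e1 e2
    rw [e1, e2]
  rw [eLpNorm_congr_ae h4, eLpNorm_planch, ← MemLp.toLp_sub, eLpNorm_congr_ae (MemLp.coeFn_toLp _)]
  rfl

theorem tendsto_eLpNorm_laplaceFourier_sub (h0 : ∀ x ≤ 0, φ x = 0)
    (h : MemLp (expMul s φ) 2 volume) :
    Tendsto (fun ν : ℝ => eLpNorm (fun μ : ℝ =>
      laplaceFourier φ (μ + ν * Complex.I) - planch (h.toLp _) μ) 2 volume) (𝓝[<] s) (𝓝 0) := by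
  simp only [laplaceFourier_add_mul_I]
  refine tendsto_eLpNorm_planch_sub h ?_ ?_ ?_
  · filter_upwards [self_mem_nhdsWithin] with ν hν using memLp_expMul h0 h (le_of_lt hν)
  · filter_upwards [self_mem_nhdsWithin] with ν hν using integrable_expMul h0 h hν
  · refine (tendsto_eLpNorm_mul_sub h (m := fun ν => expKernel (s - ν) 0)
      (Eventually.of_forall fun ν => (continuous_expKernel _ _).aestronglyMeasurable) ?_
      fun x _ => tendsto_expKernel s x).congr fun ν => ?_
    · filter_upwards [self_mem_nhdsWithin] with ν hν x
      exact norm_expKernel_le_one (sub_nonneg.2 (le_of_lt hν)) _ _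
    · simp only [← expMul_eq_expKernel_mul h0]

/-- The transform on the line of height `ν` is the Abel mean, with parameter `ε = s - ν`, of the
Fourier integral at height `s`. It is therefore `π⁻¹` times a Poisson integral of the `L²`
transform. -/
theorem ae_tendsto_laplaceFourier (h0 : ∀ x ≤ 0, φ x = 0) (h : MemLp (expMul s φ) 2 volume) :
    ∀ᵐ μ : ℝ, Tendsto (fun ν : ℝ => laplaceFourier φ (μ + ν * Complex.I)) (𝓝[<] s)
      (𝓝 (planch (h.toLp _) μ)) := by
  filter_upwards [ae_tendsto_integral_poisson_mul (memLp_planch (h.toLp _))] with μ hμ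
  have h1 : Tendsto (fun ν : ℝ => s - ν) (𝓝[<] s) (𝓝[>] 0) := by
    refine tendsto_nhdsWithin_iff.2 ⟨?_, ?_⟩
    · have : Continuous fun ν : ℝ => s - ν := by fun_prop
      simpa using (this.tendsto s).mono_left nhdsWithin_le_nhds
    · filter_upwards [self_mem_nhdsWithin] with ν hν
      exact mem_Ioi.2 (sub_pos.2 (mem_Iio.1 hν))
  have hpi : (Real.pi : ℂ) ≠ 0 := by exact_mod_cast Real.pi_ne_zero
  have h2 := (hμ.comp h1).const_mul (Real.pi : ℂ)⁻¹
  rw [inv_mul_cancel_left₀ hpi] at h2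
  refine h2.congr' ?_
  filter_upwards [self_mem_nhdsWithin] with ν hν
  have hε : 0 < s - ν := sub_pos.2 (mem_Iio.1 hν)
  rw [Function.comp_apply, integral_poisson_mul_planch _ hε, inv_mul_cancel_left₀ hpi,
    laplaceFourier_add_mul_I, laplaceFourier]
  refine integral_congr_ae ?_
  filter_upwards [h.coeFn_toLp] with x hx
  rw [hx, expMul_eq_expKernel_mul (s := s) h0 ν, ← mul_assoc]
  congr 1
  rw [expKernel, expKernel, ← Complex.exp_conj, ← Complex.exp_add]
  congr 1
  simp
  ring

theorem tendsto_eLpNorm_laplaceFourier_truncation_sub (h0 : ∀ x ≤ 0, φ x = 0)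
    (h : MemLp (expMul s φ) 2 volume) :
    Tendsto (fun N : ℝ => eLpNorm (fun μ : ℝ =>
      laplaceFourier ((Ioc 0 N).indicator (expMul s φ)) μ - planch (h.toLp _) μ) 2 volume)
      atTop (𝓝 0) := by
  refine tendsto_eLpNorm_planch_sub h ?_ ?_ ?_
  · exact Eventually.of_forall fun N => h.indicator measurableSet_Ioc
  · refine Eventually.of_forall fun N => (integrable_indicator_iff measurableSet_Ioc).2 ?_
    have : IsFiniteMeasure (volume.restrict (Ioc 0 N)) := ⟨by simp⟩
    exact (h.restrict (Ioc 0 N)).integrable (by norm_num)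
  · refine (tendsto_eLpNorm_mul_sub h (m := fun N => (Ioc 0 N).indicator fun _ => 1)
      (Eventually.of_forall fun N => aestronglyMeasurable_const.indicator measurableSet_Ioc)
      (Eventually.of_forall fun N x => ?_) fun x hx => ?_).congr fun N => ?_
    · exact (norm_indicator_le_norm_self _ _).trans (by simp)
    · have hx0 : 0 < x := by
        by_contra hx0
        exact hx (by simp [expMul, h0 x (not_lt.1 hx0)])
      refine tendsto_const_nhds.congr' ?_
      filter_upwards [eventually_ge_atTop x] with N hN
      rw [indicator_of_mem (show x ∈ Ioc 0 N from ⟨hx0, hN⟩)]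
    · congr 1
      funext x
      by_cases hx : x ∈ Ioc 0 N <;> simp [hx]

end HalfLine

/-! ### The Paley–Wiener theorem for a half-plane -/

/-- The integrals of a holomorphic function over the horizontal lines of a strip agree if its
`L¹` norms on these lines are bounded. -/
theorem integral_line_eq_of_lintegral_le {H : ℂ → ℂ} {ν₁ ν₂ : ℝ} (h12 : ν₁ ≤ ν₂) {K : ℝ≥0}
    (hd : DifferentiableOn ℂ H {η | η.im ∈ Icc ν₁ ν₂})
    (hK : ∀ ν ∈ Icc ν₁ ν₂, ∫⁻ μ : ℝ, ‖H (μ + ν * Complex.I)‖ₑ ≤ K) :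
    ∫ μ : ℝ, H (μ + ν₁ * Complex.I) = ∫ μ : ℝ, H (μ + ν₂ * Complex.I) := by
  have hcont {X : Type} [TopologicalSpace X] {e : X → ℂ} {s : Set X} (he : Continuous e)
      (hs : ∀ x ∈ s, (e x).im ∈ Icc ν₁ ν₂) : ContinuousOn (fun x => H (e x)) s :=
    hd.continuousOn.comp he.continuousOn hs
  have hint (ν : ℝ) (hν : ν ∈ Icc ν₁ ν₂) :
      Integrable (fun μ : ℝ => H (μ + ν * Complex.I)) volume := by
    refine ⟨(continuousOn_univ.1 (hcont (by fun_prop) fun x _ => ?_)).aestronglyMeasurable,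
      lt_of_le_of_lt (hK ν hν) ENNReal.coe_lt_top⟩
    simpa using hν
  have hprod : Integrable (fun p : ℝ × ℝ => H (p.1 + p.2 * Complex.I))
      (volume.prod (volume.restrict (Ioc ν₁ ν₂))) := by
    have hm : AEStronglyMeasurable (fun p : ℝ × ℝ => H (p.1 + p.2 * Complex.I))
        (volume.prod (volume.restrict (Ioc ν₁ ν₂))) := by
      nth_rw 1 [← Measure.restrict_univ (μ := (volume : Measure ℝ))]
      rw [Measure.prod_restrict]
      refine ContinuousOn.aestronglyMeasurable (hcont (by fun_prop) fun p hp => ?_)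
        (MeasurableSet.univ.prod measurableSet_Ioc)
      simpa using Ioc_subset_Icc_self hp.2
    refine ⟨hm, ?_⟩
    rw [HasFiniteIntegral, lintegral_prod_symm _ hm.enorm]
    calc ∫⁻ ν in Ioc ν₁ ν₂, ∫⁻ μ : ℝ, ‖H (μ + ν * Complex.I)‖ₑ
        ≤ ∫⁻ _ in Ioc ν₁ ν₂, K :=
          setLIntegral_mono' measurableSet_Ioc fun ν hν => hK ν (Ioc_subset_Icc_self hν)
      _ < ∞ := by
          rw [setLIntegral_const, Real.volume_Ioc]
          exact ENNReal.mul_lt_top ENNReal.coe_lt_top ENNReal.ofReal_lt_top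
  -- The integral over a vertical side; by Fubini on the strip it is integrable in `R`.
  set V : ℝ → ℂ := fun R => ∫ y in ν₁..ν₂, H (R + y * Complex.I) with hV
  have hVi : Integrable V volume := by
    have := hprod.integral_prod_left
    simpa only [hV, intervalIntegral.integral_of_le h12] using this
  have hrect (R : ℝ) : (∫ x in (-R)..R, H (x + ν₁ * Complex.I)) -
      (∫ x in (-R)..R, H (x + ν₂ * Complex.I)) = Complex.I • V (-R) - Complex.I • V R := by
    have := Complex.integral_boundary_rect_eq_zero_of_differentiableOn H ⟨-R, ν₁⟩ ⟨R, ν₂⟩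
      (hd.mono fun η hη => by
        have := hη.2
        simpa [uIcc_of_le h12] using this)
    simp only [hV]
    linear_combination this
  have hlim := ((intervalIntegral_tendsto_integral (hint ν₁ ⟨le_rfl, h12⟩) tendsto_neg_atTop_atBot
    tendsto_id).sub (intervalIntegral_tendsto_integral (hint ν₂ ⟨h12, le_rfl⟩)
    tendsto_neg_atTop_atBot tendsto_id)).congr hrect
  have hi : Integrable (fun R => Complex.I • V (-R) - Complex.I • V R) volume :=
    (hVi.comp_neg.smul Complex.I).sub (hVi.smul Complex.I)
  -- No pointwise decay of `V` is known. But the difference of the side integrals converges as `R →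
  -- ∞` and is integrable, so its limit can only be `0`.
  refine sub_eq_zero.1 (IntegrableAtFilter.eq_zero_of_tendsto (hi.integrableAtFilter atTop) ?_ hlim)
  intro s hs
  obtain ⟨b, hb⟩ := mem_atTop_sets.1 hs
  exact measure_mono_top (show Ici b ⊆ s from hb) Real.volume_Ici

/-- For real `ψ` this replaces the conjugate in Parseval's pairing by a function holomorphic in `μ +
νi`, so that Cauchy's theorem applies to the product. -/
theorem laplaceFourier_neg (ψ : ℝ → ℝ) (μ ν : ℝ) :
    laplaceFourier (fun x => ψ x) (-(μ + ν * Complex.I)) =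
      conj (laplaceFourier (expMul (-ν) fun x => ψ x) μ) := by
  rw [laplaceFourier, laplaceFourier, ← integral_conj]
  refine integral_congr_ae (ae_of_all _ fun x => ?_)
  simp only [expMul, map_mul, Complex.conj_ofReal, ← Complex.exp_conj]
  rw [← mul_assoc, Complex.ofReal_exp, ← Complex.exp_add]
  congr 2
  simp
  linear_combination ((ν : ℂ) * x) * Complex.I_sq

theorem continuous_expMul {ν : ℝ} {φ : ℝ → ℂ} (h : Continuous φ) : Continuous (expMul ν φ) := by
  unfold expMul
  fun_prop

theorem locallyIntegrable_expMul {ν : ℝ} {φ : ℝ → ℂ} (h : LocallyIntegrable φ volume) :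
    LocallyIntegrable (expMul ν φ) volume := by
  refine (locallyIntegrable_iff).2 fun K hK => ?_
  exact (h.integrableOn_isCompact hK).continuousOn_mul (by fun_prop) hK

/-- The inverse Fourier transforms of the restrictions of a Hardy function to two horizontal lines
differ by an exponential factor. -/
theorem expMul_ae_eq_of_planch_ae_eq {G : ℂ → ℂ} {ν₁ ν₂ : ℝ} {C : ℝ≥0} (h12 : ν₁ ≤ ν₂)
    (hd : DifferentiableOn ℂ G {η | η.im ∈ Icc ν₁ ν₂})
    (hC : ∀ ν ∈ Icc ν₁ ν₂, eLpNorm (fun μ : ℝ => G (μ + ν * Complex.I)) 2 volume ≤ C)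
    {h₁ h₂ : Lp ℂ 2 (volume : Measure ℝ)}
    (e₁ : planch h₁ =ᵐ[volume] fun μ : ℝ => G (μ + ν₁ * Complex.I))
    (e₂ : planch h₂ =ᵐ[volume] fun μ : ℝ => G (μ + ν₂ * Complex.I)) :
    expMul (-ν₁) h₁ =ᵐ[volume] expMul (-ν₂) h₂ := by
  have hloc (h : Lp ℂ 2 (volume : Measure ℝ)) (ν : ℝ) :
      LocallyIntegrable (expMul ν h) volume :=
    locallyIntegrable_expMul ((Lp.memLp h).locallyIntegrable (by norm_num))
  refine ae_eq_of_integral_contDiff_smul_eq (hloc _ _) (hloc _ _) fun ψ hψ hψc => ?_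
  have hcψ : Continuous fun x => (ψ x : ℂ) := Complex.continuous_ofReal.comp hψ.continuous
  have hsψ (ν : ℝ) : HasCompactSupport (expMul ν fun x => (ψ x : ℂ)) :=
    (hψc.comp_left Complex.ofReal_zero).mul_left
  have hiψ (ν : ℝ) : Integrable (expMul ν fun x => (ψ x : ℂ)) volume :=
    (continuous_expMul hcψ).integrable_of_hasCompactSupport (hsψ ν)
  have hmψ (ν : ℝ) : MemLp (expMul ν fun x => (ψ x : ℂ)) 2 volume :=
    (continuous_expMul hcψ).memLp_of_hasCompactSupport (hsψ ν)
  have heq (ν : ℝ) : (fun μ : ℝ => laplaceFourier (fun x => ψ x) (-(μ + ν * Complex.I))) =ᵐ[volume]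
      fun μ => conj (planch ((hmψ (-ν)).toLp _) μ) := by
    filter_upwards [planch_ae_eq (hmψ (-ν)) (hiψ (-ν))] with μ hμ
    rw [laplaceFourier_neg, hμ]
  have hdΨ : Differentiable ℂ fun η => laplaceFourier (fun x => ψ x) (-η) := fun η =>
    (differentiableAt_laplaceFourier one_pos (hiψ _) (hiψ _)).comp η differentiableAt_id.neg
  -- Parseval on a single line: the right side sees the candidate `e^{-νx} h` tested against `ψ`,
  -- the left side is a line integral of a holomorphic function.
  have hpair (ν : ℝ) (h : Lp ℂ 2 (volume : Measure ℝ))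
      (e : planch h =ᵐ[volume] fun μ : ℝ => G (μ + ν * Complex.I)) :
      ∫ μ : ℝ, G (μ + ν * Complex.I) * laplaceFourier (fun x => ψ x) (-(μ + ν * Complex.I)) =
        (2 * Real.pi : ℝ) * ∫ x, ψ x • expMul (-ν) h x := by
    have h1 := integral_conj_planch_mul ((hmψ (-ν)).toLp _) h
    have h2 : ∫ x, conj ((hmψ (-ν)).toLp _ x) * h x = ∫ x, ψ x • expMul (-ν) h x := by
      refine integral_congr_ae ?_
      filter_upwards [(hmψ (-ν)).coeFn_toLp] with x hx
      rw [hx, expMul, expMul, map_mul, Complex.conj_ofReal, Complex.conj_ofReal, Complex.real_smul]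
      ring
    rw [← h2, ← h1]
    refine integral_congr_ae ?_
    filter_upwards [heq ν, e] with μ hμ hμ'
    rw [hμ, hμ', mul_comm]
  set B : ℝ≥0∞ := ENNReal.ofReal (√(2 * Real.pi)) *
    (eLpNorm (expMul (-ν₁) fun x => (ψ x : ℂ)) 2 volume +
      eLpNorm (expMul (-ν₂) fun x => (ψ x : ℂ)) 2 volume) with hB
  have hBtop : B ≠ ∞ := ENNReal.mul_ne_top ENNReal.ofReal_ne_top
    (ENNReal.add_ne_top.2 ⟨(hmψ _).2.ne, (hmψ _).2.ne⟩)
  have hΨ (ν : ℝ) (hν : ν ∈ Icc ν₁ ν₂) : eLpNorm (fun μ : ℝ =>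
      laplaceFourier (fun x => ψ x) (-(μ + ν * Complex.I))) 2 volume ≤ B := by
    have h3 : eLpNorm (fun μ => conj (planch ((hmψ (-ν)).toLp _) μ)) 2 volume =
        eLpNorm (planch ((hmψ (-ν)).toLp _)) 2 volume :=
      eLpNorm_congr_norm_ae (ae_of_all _ fun μ => by simp)
    rw [eLpNorm_congr_ae (heq ν), h3, eLpNorm_planch, eLpNorm_congr_ae (MemLp.coeFn_toLp _), hB]
    refine mul_le_mul_right ?_ _
    -- For `x ≥ 0` the weight is largest at `ν₁`, for `x ≤ 0` at `ν₂`; this makes the bound uniform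
    -- over the strip.
    have h4 : ∀ x, ‖expMul (-ν) (fun x => (ψ x : ℂ)) x‖ ≤
        ‖expMul (-ν₁) (fun x => (ψ x : ℂ)) x‖ + ‖expMul (-ν₂) (fun x => (ψ x : ℂ)) x‖ := by
      intro x
      simp only [norm_expMul, ← add_mul]
      gcongr
      rcases le_total 0 x with hx | hx
      · exact le_add_of_le_of_nonneg (Real.exp_le_exp.2 (by nlinarith [hν.1])) (Real.exp_pos _).le
      · exact le_add_of_nonneg_of_le (Real.exp_pos _).le (Real.exp_le_exp.2 (by nlinarith [hν.2]))
    have h5 := eLpNorm_add_le (μ := volume) (p := 2) (hmψ (-ν₁)).1.norm (hmψ (-ν₂)).1.norm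
      (by norm_num)
    rw [eLpNorm_norm, eLpNorm_norm] at h5
    refine le_trans (eLpNorm_mono_real h4) h5
  have hline := integral_line_eq_of_lintegral_le h12 (K := (C * B).toNNReal)
    (hd.mul hdΨ.differentiableOn) fun ν hν => by
      have h5 : AEStronglyMeasurable (fun μ : ℝ => G (μ + ν * Complex.I)) volume :=
        (hd.continuousOn.comp_continuous (by fun_prop) fun μ : ℝ => by simpa using hν
          ).aestronglyMeasurable
      have h6 := (hdΨ.continuous.comp (by fun_prop : Continuous fun μ : ℝ => μ + ν * Complex.I)
        ).aestronglyMeasurable (μ := volume)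
      have h7 := eLpNorm_smul_le_mul_eLpNorm (p := 2) (q := 2) (r := 1) h6 h5
      rw [eLpNorm_one_eq_lintegral_enorm] at h7
      rw [ENNReal.coe_toNNReal (ENNReal.mul_ne_top ENNReal.coe_ne_top hBtop)]
      exact h7.trans (mul_le_mul' (hC ν hν) (hΨ ν hν))
  simp only [Pi.mul_apply] at hline
  rw [hpair ν₁ h₁ e₁, hpair ν₂ h₂ e₂] at hline
  exact mul_left_cancel₀ (by exact_mod_cast (by positivity : 2 * Real.pi ≠ 0)) hline

theorem one_le_sqrt_two_pi : 1 ≤ √(2 * Real.pi) :=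
  Real.one_le_sqrt.2 (by linarith [Real.pi_gt_three])

/-- On `x ≤ -δ` and for `ν ≤ 0` one has `|φ| ≤ e^{νδ} |e^{νx} φ|`, so the norm of `φ` there is at
most `e^{νδ} C`, which tends to `0` as `ν → -∞`. -/
theorem ae_eq_zero_of_forall_eLpNorm_expMul_le {φ : ℝ → ℂ} {a : ℝ} {C : ℝ≥0}
    (hφ : AEStronglyMeasurable φ volume) (h : ∀ ν < a, eLpNorm (expMul ν φ) 2 volume ≤ C) :
    ∀ᵐ x : ℝ, x < 0 → φ x = 0 := by
  have key (δ : ℝ) (hδ : 0 < δ) : (Iic (-δ)).indicator φ =ᵐ[volume] 0 := by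
    rw [← eLpNorm_eq_zero_iff (p := 2) (hφ.indicator measurableSet_Iic) (by norm_num),
      ← nonpos_iff_eq_zero]
    have ht : Tendsto (fun ν : ℝ => ENNReal.ofReal (Real.exp (ν * δ)) * C) atBot (𝓝 0) := by
      have h1 : Tendsto (fun ν : ℝ => Real.exp (ν * δ)) atBot (𝓝 0) :=
        Real.tendsto_exp_atBot.comp (tendsto_id.atBot_mul_const hδ)
      simpa using ENNReal.Tendsto.mul_const (ENNReal.tendsto_ofReal h1)
        (Or.inr (ENNReal.coe_ne_top (r := C)))
    refine ge_of_tendsto ht ?_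
    filter_upwards [eventually_lt_atBot a, eventually_le_atBot 0] with ν hν hν0
    refine (eLpNorm_le_mul_eLpNorm_of_ae_le_mul (c := Real.exp (ν * δ)) (g := expMul ν φ)
      (ae_of_all _ fun x => ?_) 2).trans (mul_le_mul_right (h ν hν) _)
    by_cases hx : x ∈ Iic (-δ)
    · rw [indicator_of_mem hx, norm_expMul, ← mul_assoc, ← Real.exp_add]
      refine le_mul_of_one_le_left (norm_nonneg _) (Real.one_le_exp ?_)
      have : x ≤ -δ := hx
      nlinarith
    · rw [indicator_of_notMem hx, norm_zero]
      positivity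
  have h1 : ∀ᵐ x : ℝ, ∀ n : ℕ, (Iic (-(1 / ((n : ℝ) + 1)))).indicator φ x = 0 :=
    ae_all_iff.2 fun n => key _ (by positivity)
  filter_upwards [h1] with x hx hx0
  obtain ⟨n, hn⟩ := exists_nat_one_div_lt (neg_pos.2 hx0)
  have := hx n
  rwa [indicator_of_mem (show x ∈ Iic (-(1 / ((n : ℝ) + 1))) from by
    rw [mem_Iic]; linarith)] at this

/-- Fatou's lemma along `ν = a - 1/(n+1)`. -/
theorem eLpNorm_expMul_le_of_forall_lt {φ : ℝ → ℂ} {a : ℝ} {C : ℝ≥0∞}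
    (hφ : AEStronglyMeasurable φ volume) (h : ∀ ν < a, eLpNorm (expMul ν φ) 2 volume ≤ C) :
    eLpNorm (expMul a φ) 2 volume ≤ C := by
  have hm (ν : ℝ) : AEStronglyMeasurable (expMul ν φ) volume :=
    aestronglyMeasurable_expMul (ν := 0) (by rwa [expMul_zero])
  refine (Lp.eLpNorm_lim_le_liminf_eLpNorm (f := fun n : ℕ => expMul (a - 1 / ((n : ℝ) + 1)) φ)
    (fun n => hm _) _ (ae_of_all _ fun x => ?_)).trans
    (liminf_le_of_frequently_le' (Frequently.of_forall fun n => h _ ?_))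
  · have h1 : Continuous fun ν : ℝ => expMul ν φ x := by
      unfold expMul
      fun_prop
    have h2 : Tendsto (fun n : ℕ => a - 1 / ((n : ℝ) + 1)) atTop (𝓝 a) := by
      simpa using (tendsto_one_div_add_atTop_nhds_zero_nat (𝕜 := ℝ)).const_sub a
    exact (h1.tendsto a).comp h2
  · have : (0 : ℝ) < 1 / ((n : ℝ) + 1) := by positivity
    linarith

/-- **Paley–Wiener theorem** for the half-plane `Im η < a`. -/
theorem exists_eq_laplaceFourier {G : ℂ → ℂ} {a : ℝ} {C : ℝ≥0}
    (hd : DifferentiableOn ℂ G {η | η.im < a})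
    (hC : ∀ ν < a, eLpNorm (fun μ : ℝ => G (μ + ν * Complex.I)) 2 volume ≤ C) :
    ∃ φ : ℝ → ℂ, (∀ x ≤ 0, φ x = 0) ∧ MemLp (expMul a φ) 2 volume ∧
      ∀ η : ℂ, η.im < a → G η = laplaceFourier φ η := by
  have hcG (ν : ℝ) (hν : ν < a) : Continuous fun μ : ℝ => G (μ + ν * Complex.I) :=
    hd.continuousOn.comp_continuous (by fun_prop) fun μ => by simpa using hν
  have hex (ν : Iio a) : ∃ h : Lp ℂ 2 (volume : Measure ℝ),
      planch h =ᵐ[volume] fun μ : ℝ => G (μ + (ν : ℝ) * Complex.I) :=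
    exists_planch_eq ⟨(hcG ν ν.2).aestronglyMeasurable, (hC ν ν.2).trans_lt ENNReal.coe_lt_top⟩
  choose h hh using hex
  have hle (ν₁ ν₂ : Iio a) (h12 : (ν₁ : ℝ) ≤ ν₂) :
      expMul (-ν₁) (h ν₁) =ᵐ[volume] expMul (-ν₂) (h ν₂) :=
    expMul_ae_eq_of_planch_ae_eq h12 (hd.mono fun η hη => lt_of_le_of_lt hη.2 ν₂.2)
      (fun ν hν => hC ν (lt_of_le_of_lt hν.2 ν₂.2)) (hh ν₁) (hh ν₂)
  -- Any reference line would do, since `e^{-νx} h_ν` is independent of `ν`.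
  set ν₀ : Iio a := ⟨a - 1, by simp⟩
  set F : ℝ → ℂ := expMul (-ν₀) (h ν₀) with hF
  have hFν (ν : Iio a) : expMul ν F =ᵐ[volume] h ν := by
    have h1 : F =ᵐ[volume] expMul (-ν) (h ν) := by
      rcases le_total (ν₀ : ℝ) ν with hν | hν
      · exact hle _ _ hν
      · exact (hle _ _ hν).symm
    filter_upwards [h1] with x hx
    have h2 : expMul ν (expMul (-ν) (h ν)) = h ν := by
      rw [expMul_expMul, add_neg_cancel, expMul_zero]
    rw [← h2, expMul, hx]
    rfl
  have hFm : AEStronglyMeasurable F volume :=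
    aestronglyMeasurable_expMul (ν := 0) (by rw [expMul_zero]; exact (Lp.memLp _).1)
  have hFC (ν : ℝ) (hν : ν < a) : eLpNorm (expMul ν F) 2 volume ≤ C := by
    rw [eLpNorm_congr_ae (hFν ⟨ν, hν⟩)]
    refine le_trans ?_ (hC ν hν)
    rw [← eLpNorm_congr_ae (hh ⟨ν, hν⟩), eLpNorm_planch]
    exact le_mul_of_one_le_left (by positivity) (ENNReal.one_le_ofReal.2 one_le_sqrt_two_pi)
  -- The cut-off changes `F` only on a null set and makes it vanish at every `x ≤ 0`.
  set φ : ℝ → ℂ := (Ioi 0).indicator F with hφ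
  have hφF : φ =ᵐ[volume] F := by
    filter_upwards [ae_eq_zero_of_forall_eLpNorm_expMul_le hFm hFC,
      compl_mem_ae_iff.2 (measure_singleton (0 : ℝ))] with x hx hx0
    by_cases hx1 : x ∈ Ioi 0
    · rw [hφ, indicator_of_mem hx1]
    · rw [hφ, indicator_of_notMem hx1, hx (lt_of_le_of_ne (not_lt.1 hx1) hx0)]
  have hφν (ν : ℝ) : expMul ν φ =ᵐ[volume] expMul ν F := by
    filter_upwards [hφF] with x hx
    rw [expMul, hx, expMul]
  have h0 : ∀ x ≤ 0, φ x = 0 := fun x hx => indicator_of_notMem (by simpa using hx) _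
  have hφm : MemLp (expMul a φ) 2 volume := by
    rw [memLp_congr_ae (hφν a)]
    exact ⟨aestronglyMeasurable_expMul (ν := 0) (by rwa [expMul_zero]),
      (eLpNorm_expMul_le_of_forall_lt hFm hFC).trans_lt ENNReal.coe_lt_top⟩
  refine ⟨φ, h0, hφm, fun η hη => ?_⟩
  have hL : Continuous fun μ : ℝ => laplaceFourier φ (μ + η.im * Complex.I) := by
    have : DifferentiableOn ℂ (laplaceFourier φ) {η | η.im < a} := fun z hz =>
      (differentiableAt_laplaceFourier_of_im_lt h0 hφm hz).differentiableWithinAt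
    exact this.continuousOn.comp_continuous (by fun_prop) fun μ => by simpa using hη
  have hae : (fun μ : ℝ => G (μ + η.im * Complex.I)) =ᵐ[volume]
      fun μ : ℝ => laplaceFourier φ (μ + η.im * Complex.I) := by
    have h1 := memLp_expMul h0 hφm hη.le
    have h2 : h1.toLp _ = h ⟨η.im, hη⟩ :=
      Lp.ext (h1.coeFn_toLp.trans ((hφν _).trans (hFν ⟨η.im, hη⟩)))
    have h3 := planch_ae_eq h1 (integrable_expMul h0 hφm hη)
    rw [h2] at h3
    simp only [laplaceFourier_add_mul_I]
    exact (hh ⟨η.im, hη⟩).symm.trans h3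
  -- Both sides are continuous on the line, so equality almost everywhere is equality everywhere.
  have := congrFun (((hcG _ hη).ae_eq_iff_eq volume hL).1 hae) η.re
  simpa only [Complex.re_add_im] using this

/-! ### Geometry of the three rays and half-planes -/

theorem sq_sqrt_three : ((√3 : ℝ) : ℂ) ^ 2 = 3 := by
  rw [← Complex.ofReal_pow, Real.sq_sqrt (by norm_num)]
  norm_num

theorem conjIdx_zero : conjIdx 0 = 0 := by decide

theorem conjIdx_one : conjIdx 1 = 2 := by decide

theorem conjIdx_two : conjIdx 2 = 1 := by decide

theorem zeta_zero : zeta 0 = 1 := rfl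

theorem zeta_one : zeta 1 = (-1 + Complex.I * (√3 : ℝ)) / 2 := rfl

theorem zeta_two : zeta 2 = (-1 - Complex.I * (√3 : ℝ)) / 2 := rfl

theorem zeta_conjIdx_mul_zeta (k : Fin 3) : zeta (conjIdx k) * zeta k = 1 := by
  have h := sq_sqrt_three
  match k with
  | 0 => rw [conjIdx_zero, zeta_zero, one_mul]
  | 1 =>
    rw [conjIdx_one, zeta_one, zeta_two]
    linear_combination (-1 / 4 * Complex.I ^ 2) * h + (-3 / 4) * Complex.I_sq
  | 2 =>
    rw [conjIdx_two, zeta_one, zeta_two]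
    linear_combination (-1 / 4 * Complex.I ^ 2) * h + (-3 / 4) * Complex.I_sq

theorem conjIdx_conjIdx (k : Fin 3) : conjIdx (conjIdx k) = k := Equiv.swap_apply_self _ _ _

theorem zeta_mul_zeta_conjIdx (k : Fin 3) : zeta k * zeta (conjIdx k) = 1 := by
  rw [mul_comm, zeta_conjIdx_mul_zeta]

theorem zeta_ne_zero (k : Fin 3) : zeta k ≠ 0 := right_ne_zero_of_mul_eq_one (zeta_conjIdx_mul_zeta k)

theorem norm_zeta (k : Fin 3) : ‖zeta k‖ = 1 := by
  have h : ∀ k, zeta (conjIdx k) = (starRingEnd ℂ) (zeta k) := by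
    intro k
    match k with
    | 0 => simp [conjIdx_zero, zeta_zero]
    | 1 => simp [conjIdx_one, zeta_one, zeta_two, sub_eq_add_neg, map_ofNat]
    | 2 => simp [conjIdx_two, zeta_one, zeta_two, sub_eq_add_neg, map_ofNat]
  have h2 := zeta_conjIdx_mul_zeta k
  rw [h, ← Complex.normSq_eq_conj_mul_self] at h2
  have h3 : Complex.normSq (zeta k) = 1 := by exact_mod_cast h2
  rw [← Complex.sq_norm] at h3
  exact (pow_eq_one_iff_of_nonneg (norm_nonneg _) two_ne_zero).1 h3

/-- Two distinct lines `ℝ ζ_j`, `ℝ ζ_k` meet only at the origin; this is what permits gluing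
functions given on the lines. -/
theorem im_zeta_mul_zeta_conjIdx_ne_zero {j k : Fin 3} (h : j ≠ k) :
    (zeta j * zeta (conjIdx k)).im ≠ 0 := by
  have h3 : √3 ≠ (0 : ℝ) := by positivity
  have him : (zeta j * zeta (conjIdx k)).im = (zeta j).im * (zeta (conjIdx k)).re +
      (zeta j).re * (zeta (conjIdx k)).im := by rw [Complex.mul_im]; ring
  have h0 : (zeta 0).re = 1 ∧ (zeta 0).im = 0 := by simp [zeta_zero]
  have h1 : (zeta 1).re = -1 / 2 ∧ (zeta 1).im = √3 / 2 := by simp [zeta_one]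
  have h2 : (zeta 2).re = -1 / 2 ∧ (zeta 2).im = -√3 / 2 := by simp [zeta_two]
  rw [him]
  intro hz
  refine h3 ?_
  match j, k with
  | 0, 0 | 1, 1 | 2, 2 => exact absurd rfl h
  | 0, 1 => rw [conjIdx_one, h0.1, h0.2, h2.1, h2.2] at hz; linarith
  | 0, 2 => rw [conjIdx_two, h0.1, h0.2, h1.1, h1.2] at hz; linarith
  | 1, 0 => rw [conjIdx_zero, h1.1, h1.2, h0.1, h0.2] at hz; linarith
  | 1, 2 => rw [conjIdx_two, h1.1, h1.2] at hz; linarith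
  | 2, 0 => rw [conjIdx_zero, h2.1, h2.2, h0.1, h0.2] at hz; linarith
  | 2, 1 => rw [conjIdx_one, h2.1, h2.2] at hz; linarith

theorem halfPlane_eq (k : Fin 3) (a : ℝ) : halfPlane k a = {z | (zeta (conjIdx k) * z).im < a} := by
  ext z
  constructor
  · rintro ⟨η, hη, rfl⟩
    rwa [mem_ofPred_eq, ← mul_assoc, zeta_conjIdx_mul_zeta, one_mul]
  · intro hz
    exact ⟨zeta (conjIdx k) * z, hz, by rw [← mul_assoc, zeta_mul_zeta_conjIdx, one_mul]⟩

theorem isOpen_halfPlane (k : Fin 3) (a : ℝ) : IsOpen (halfPlane k a) := by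
  rw [halfPlane_eq]
  exact isOpen_lt (by fun_prop) continuous_const

theorem interior_closure_halfPlane (k : Fin 3) (a : ℝ) :
    interior (closure (halfPlane k a)) = halfPlane k a := by
  have : halfPlane k a = (Homeomorph.mulLeft₀ _ (zeta_ne_zero (conjIdx k))) ⁻¹' {z | z.im < a} :=
    halfPlane_eq k a
  rw [this, ← Homeomorph.preimage_closure, ← Homeomorph.preimage_interior,
    Complex.closure_setOfPred_im_lt, Complex.interior_setOfPred_im_le]

theorem mem_halfPlane_of_mem_triangle {a : ℝ} {z : ℂ} (hz : z ∈ triangle a) {k : Fin 3}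
    (h : z ∉ frontier (halfPlane k a)) : z ∈ halfPlane k a := by
  by_contra hn
  refine h ?_
  rw [(isOpen_halfPlane k a).frontier_eq]
  exact ⟨mem_iInter.1 hz k, hn⟩

theorem mem_halfPlane_of_mem_interior_triangle {a : ℝ} {z : ℂ} (hz : z ∈ interior (triangle a))
    (k : Fin 3) : z ∈ halfPlane k a := by
  rw [← interior_closure_halfPlane]
  exact interior_mono (iInter_subset _ k) hz

/-! ### Square integrable functions on bundles of lines through the origin -/

theorem measurableEmbedding_mul_zeta (k : Fin 3) :
    MeasurableEmbedding (fun x : ℝ => (x : ℂ) * zeta k) := by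
  refine (Isometry.isClosedEmbedding (Isometry.of_dist_eq fun x y => ?_)).measurableEmbedding
  rw [dist_eq_norm, ← sub_mul, norm_mul, norm_zeta, mul_one, ← Complex.ofReal_sub,
    Complex.norm_real, Real.dist_eq, Real.norm_eq_abs]

/-- The image of a measure on `ℝ` on the bundle of the three lines `ℝ ζ_k`. -/
noncomputable def bundleMeasure (m : Measure ℝ) : Measure ℂ :=
  ∑ k : Fin 3, m.map (fun x : ℝ => (x : ℂ) * zeta k)

section Bundle

variable {m : Measure ℝ} {M : Measure ℂ}

theorem ae_bundleMeasure_iff {p : ℂ → Prop} :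
    (∀ᵐ z ∂bundleMeasure m, p z) ↔ ∀ k : Fin 3, ∀ᵐ x : ℝ ∂m, p ((x : ℂ) * zeta k) := by
  rw [bundleMeasure, ← Measure.sum_fintype, Measure.ae_sum_iff]
  exact forall_congr' fun k => (measurableEmbedding_mul_zeta k).ae_map_iff (p := p) (μ := m)

theorem aestronglyMeasurable_bundleMeasure_iff {f : ℂ → ℂ} :
    AEStronglyMeasurable f (bundleMeasure m) ↔
      ∀ k : Fin 3, AEStronglyMeasurable (fun x : ℝ => f ((x : ℂ) * zeta k)) m := by
  rw [bundleMeasure, ← Measure.sum_fintype, aestronglyMeasurable_sum_measure_iff]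
  exact forall_congr' fun k => (measurableEmbedding_mul_zeta k).aestronglyMeasurable_map_iff

theorem eLpNorm_two_sq {α : Type*} [MeasurableSpace α] {ρ : Measure α} (f : α → ℂ) :
    eLpNorm f 2 ρ ^ 2 = ∫⁻ x, ‖f x‖ₑ ^ 2 ∂ρ := by
  rw [eLpNorm_eq_lintegral_rpow_enorm_toReal (by norm_num) (by norm_num), ← ENNReal.rpow_natCast,
    ← ENNReal.rpow_mul]
  simp

theorem eLpNorm_bundleMeasure_sq (f : ℂ → ℂ) :
    eLpNorm f 2 (bundleMeasure m) ^ 2 =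
      ∑ k : Fin 3, eLpNorm (fun x : ℝ => f ((x : ℂ) * zeta k)) 2 m ^ 2 := by
  simp only [eLpNorm_two_sq]
  rw [bundleMeasure, lintegral_finsetSum_measure]
  exact Finset.sum_congr rfl fun k _ => (measurableEmbedding_mul_zeta k).lintegral_map _

theorem memLp_bundleMeasure_iff {f : ℂ → ℂ} : MemLp f 2 (bundleMeasure m) ↔
    ∀ k : Fin 3, MemLp (fun x : ℝ => f ((x : ℂ) * zeta k)) 2 m := by
  have h2 (x : ℝ≥0∞) : x < ∞ ↔ x ^ 2 < ∞ := by simp [ENNReal.pow_lt_top_iff]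
  simp only [MemLp, aestronglyMeasurable_bundleMeasure_iff, forall_and,
    h2 (eLpNorm _ 2 _), eLpNorm_bundleMeasure_sq, ENNReal.sum_lt_top, Finset.mem_univ, true_imp_iff]

theorem norm_bundleMeasure_sq (hM : M = bundleMeasure m) (f : Lp ℂ 2 M) :
    ‖f‖ ^ 2 = ∑ k : Fin 3, (eLpNorm (fun x : ℝ => f ((x : ℂ) * zeta k)) 2 m).toReal ^ 2 := by
  subst hM
  have h := memLp_bundleMeasure_iff.1 (Lp.memLp f)
  rw [Lp.norm_def, ← ENNReal.toReal_pow, eLpNorm_bundleMeasure_sq, ENNReal.toReal_sum]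
  · simp only [ENNReal.toReal_pow]
  · exact fun k _ => ENNReal.pow_ne_top (h k).2.ne

/-- The lines overlap only at the origin, which is null because `m ≪ volume`, so the components can
be prescribed independently. -/
theorem exists_bundle_eq (hM : M = bundleMeasure m) (hm : m ≪ volume) {h : Fin 3 → ℝ → ℂ} (hh : ∀ k, MemLp (h k) 2 m) :
    ∃ f : Lp ℂ 2 M, ∀ k : Fin 3,
      (fun x : ℝ => f ((x : ℂ) * zeta k)) =ᵐ[m] h k := by
  subst hM
  -- On the `k`-th line `(zeta (conjIdx k) * z).re` recovers the coordinate `x` of `z = x ζ_k`.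
  set f₀ : ℂ → ℂ := fun z => ∑ k : Fin 3, (range fun x : ℝ => (x : ℂ) * zeta k).indicator
    (fun z => h k (zeta (conjIdx k) * z).re) z with hf₀
  have h0 : ∀ᵐ x : ℝ ∂m, x ≠ 0 := hm (compl_mem_ae_iff.2 (measure_singleton (0 : ℝ)))
  have hf (k : Fin 3) : (fun x : ℝ => f₀ ((x : ℂ) * zeta k)) =ᵐ[m] h k := by
    filter_upwards [h0] with x hx
    rw [hf₀]
    dsimp only
    rw [Finset.sum_eq_single k, indicator_of_mem (mem_range_self x)]
    · rw [mul_left_comm, zeta_conjIdx_mul_zeta, mul_one, Complex.ofReal_re]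
    · intro j _ hj
      refine indicator_of_notMem ?_ _
      rintro ⟨y, hy⟩
      refine im_zeta_mul_zeta_conjIdx_ne_zero hj.symm ?_
      have hy' : (y : ℂ) = x * (zeta k * zeta (conjIdx j)) := by
        linear_combination zeta (conjIdx j) * hy - y * zeta_mul_zeta_conjIdx j
      have := congrArg Complex.im hy'
      rw [Complex.ofReal_im, Complex.im_ofReal_mul] at this
      exact (mul_eq_zero.1 this.symm).resolve_left hx
    · simp
  have hmem : MemLp f₀ 2 (bundleMeasure m) :=
    memLp_bundleMeasure_iff.2 fun k => (memLp_congr_ae (hf k)).2 (hh k)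
  exact ⟨hmem.toLp f₀, fun k => EventuallyEq.trans
    ((ae_bundleMeasure_iff (p := fun z => hmem.toLp f₀ z = f₀ z)).1 hmem.coeFn_toLp k) (hf k)⟩

end Bundle

/-! ### The weighted measure on the half-line -/

/-- The measure `e^{2ax} dx` on the half-line `x > 0`. -/
noncomputable def halfLineMeasure (a : ℝ) : Measure ℝ :=
  (volume.restrict (Ioi (0 : ℝ))).withDensity (fun x => ENNReal.ofReal (Real.exp (2 * a * x)))

theorem halfLineMeasure_absolutelyContinuous (a : ℝ) :
    halfLineMeasure a ≪ volume.restrict (Ioi (0 : ℝ)) :=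
  withDensity_absolutelyContinuous _ _

theorem restrict_absolutelyContinuous_halfLineMeasure (a : ℝ) :
    volume.restrict (Ioi (0 : ℝ)) ≪ halfLineMeasure a :=
  withDensity_absolutelyContinuous' (by fun_prop)
    (ae_of_all _ fun x => (ENNReal.ofReal_pos.2 (Real.exp_pos _)).ne')

theorem eLpNorm_halfLineMeasure (a : ℝ) (g : ℝ → ℂ) :
    eLpNorm g 2 (halfLineMeasure a) = eLpNorm (expMul a ((Ioi 0).indicator g)) 2 volume := by
  refine ENNReal.pow_right_strictMono two_ne_zero |>.injective ?_
  rw [eLpNorm_two_sq, eLpNorm_two_sq, halfLineMeasure,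
    lintegral_withDensity_eq_lintegral_mul_non_measurable _ (by fun_prop)
      (ae_of_all _ fun x => ENNReal.ofReal_lt_top), ← lintegral_indicator measurableSet_Ioi]
  refine lintegral_congr fun x => ?_
  by_cases hx : x ∈ Ioi (0 : ℝ)
  · rw [indicator_of_mem hx, expMul, indicator_of_mem hx, enorm_mul, mul_pow, Pi.mul_apply,
      ← ofReal_norm (Real.exp (a * x) : ℂ), Complex.norm_real, Real.norm_of_nonneg (Real.exp_pos _).le,
      ← ENNReal.ofReal_pow (Real.exp_pos _).le, ← Real.exp_nat_mul]
    congr 3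
    push_cast
    ring
  · rw [indicator_of_notMem hx, expMul, indicator_of_notMem hx]
    simp

theorem memLp_halfLineMeasure_iff {a : ℝ} {g : ℝ → ℂ} :
    MemLp g 2 (halfLineMeasure a) ↔ MemLp (expMul a ((Ioi 0).indicator g)) 2 volume := by
  refine and_congr ?_ (by rw [eLpNorm_halfLineMeasure])
  have h1 : AEStronglyMeasurable (expMul a ((Ioi 0).indicator g)) volume ↔
      AEStronglyMeasurable ((Ioi 0).indicator g) volume := by
    constructor <;> intro h
    · simpa [expMul_zero] using aestronglyMeasurable_expMul (ν' := 0) h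
    · exact aestronglyMeasurable_expMul (ν := 0) (by rwa [expMul_zero])
  rw [h1, aestronglyMeasurable_indicator_iff measurableSet_Ioi]
  exact ⟨fun h => h.mono_ac (restrict_absolutelyContinuous_halfLineMeasure a),
    fun h => h.mono_ac (halfLineMeasure_absolutelyContinuous a)⟩

/-! ### Hardy functions as Fourier–Laplace transforms -/

section HardyLaplace

variable {φ : ℝ → ℂ} {a : ℝ}

theorem slice_of_forall_eq {k : Fin 3} {F : ℂ → ℂ}
    (hF : ∀ z ∈ halfPlane k a, F z = laplaceFourier φ (zeta (conjIdx k) * z)) {ν : ℝ} (hν : ν < a) :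
    slice k F ν = fun μ : ℝ => laplaceFourier φ (μ + ν * Complex.I) := by
  funext μ
  rw [slice, hF _ ⟨_, by simpa using hν, rfl⟩, ← mul_assoc, zeta_conjIdx_mul_zeta, one_mul]

theorem hasLineValue_planch {k : Fin 3} {F : ℂ → ℂ}
    (hF : ∀ z ∈ halfPlane k a, F z = laplaceFourier φ (zeta (conjIdx k) * z))
    (h0 : ∀ x ≤ 0, φ x = 0) {s : ℝ} (hs : s ≤ a) (h : MemLp (expMul s φ) 2 volume) :
    HasLineValue k F s (planch (h.toLp _)) := by
  refine ⟨memLp_planch _, ?_, ?_⟩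
  · refine (tendsto_eLpNorm_laplaceFourier_sub h0 h).congr' ?_
    filter_upwards [self_mem_nhdsWithin] with ν hν
    rw [slice_of_forall_eq hF (lt_of_lt_of_le hν hs)]
  · filter_upwards [ae_tendsto_laplaceFourier h0 h] with μ hμ
    refine hμ.congr' ?_
    filter_upwards [self_mem_nhdsWithin] with ν hν
    rw [slice_of_forall_eq hF (lt_of_lt_of_le hν hs)]

theorem differentiableAt_of_forall_eq {k : Fin 3} {F : ℂ → ℂ}
    (hF : ∀ z ∈ halfPlane k a, F z = laplaceFourier φ (zeta (conjIdx k) * z))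
    (h0 : ∀ x ≤ 0, φ x = 0) (h : MemLp (expMul a φ) 2 volume) {z : ℂ} (hz : z ∈ halfPlane k a) :
    DifferentiableAt ℂ F z := by
  have h1 : DifferentiableAt ℂ (fun z => laplaceFourier φ (zeta (conjIdx k) * z)) z := by
    refine (differentiableAt_laplaceFourier_of_im_lt h0 h ?_).comp z
      (differentiableAt_id.const_mul _)
    rw [halfPlane_eq] at hz
    exact hz
  refine h1.congr_of_eventuallyEq ?_
  filter_upwards [(isOpen_halfPlane k a).mem_nhds hz] with w hw using hF w hw

theorem eLpNorm_expMul_mono (h0 : ∀ x ≤ 0, φ x = 0) {ν : ℝ} (hν : ν ≤ a) :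
    eLpNorm (expMul ν φ) 2 volume ≤ eLpNorm (expMul a φ) 2 volume := by
  refine eLpNorm_mono fun x => ?_
  rw [expMul_eq_expKernel_mul (s := a) h0, norm_mul]
  exact mul_le_of_le_one_left (norm_nonneg _) (norm_expKernel_le_one (sub_nonneg.2 hν) _ _)

/-- The element of the Hardy space given by the Fourier–Laplace transform of `φ`. -/
noncomputable def hardyOfLaplace (k : Fin 3) (h0 : ∀ x ≤ 0, φ x = 0)
    (h : MemLp (expMul a φ) 2 volume) : Hardy k a :=
  ⟨(halfPlane k a).indicator fun z => laplaceFourier φ (zeta (conjIdx k) * z), by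
    have hF : ∀ z ∈ halfPlane k a, (halfPlane k a).indicator
        (fun z => laplaceFourier φ (zeta (conjIdx k) * z)) z =
        laplaceFourier φ (zeta (conjIdx k) * z) := fun z hz => indicator_of_mem hz _
    refine ⟨fun z hz => (differentiableAt_of_forall_eq hF h0 h hz).differentiableWithinAt,
      fun z hz => indicator_of_notMem hz _,
      (ENNReal.ofReal (√(2 * Real.pi)) * eLpNorm (expMul a φ) 2 volume).toNNReal, fun ν hν => ?_⟩
    rw [ENNReal.coe_toNNReal (ENNReal.mul_ne_top ENNReal.ofReal_ne_top h.2.ne),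
      slice_of_forall_eq hF hν, eLpNorm_laplaceFourier h0 h hν]
    exact mul_le_mul_right (eLpNorm_expMul_mono h0 hν.le) _⟩

theorem hardyOfLaplace_toFun (k : Fin 3) (h0 : ∀ x ≤ 0, φ x = 0)
    (h : MemLp (expMul a φ) 2 volume) : ∀ z ∈ halfPlane k a,
      (hardyOfLaplace k h0 h).toFun z = laplaceFourier φ (zeta (conjIdx k) * z) := by
  intro z hz
  change (halfPlane k a).indicator (fun z => laplaceFourier φ (zeta (conjIdx k) * z)) z = _
  exact indicator_of_mem hz _

/-- The weighted norms increase with `ν`, and by Fatou's lemma their supremum over `ν < a` is the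
norm at `a`. -/
theorem norm_hardyOfLaplace (k : Fin 3) (h0 : ∀ x ≤ 0, φ x = 0)
    (h : MemLp (expMul a φ) 2 volume) :
    ‖hardyOfLaplace k h0 h‖ = √(2 * Real.pi) * (eLpNorm (expMul a φ) 2 volume).toReal := by
  have hs (ν : ℝ) (hν : ν < a) : eLpNorm (slice k (hardyOfLaplace k h0 h).toFun ν) 2 volume =
      ENNReal.ofReal (√(2 * Real.pi)) * eLpNorm (expMul ν φ) 2 volume := by
    rw [slice_of_forall_eq (hardyOfLaplace_toFun k h0 h) hν, eLpNorm_laplaceFourier h0 h hν]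
  have hφ : AEStronglyMeasurable φ volume := by
    simpa [expMul_zero] using aestronglyMeasurable_expMul (ν' := 0) h.1
  have hsup : (⨆ ν : Iio a, eLpNorm (expMul ν φ) 2 volume) = eLpNorm (expMul a φ) 2 volume :=
    le_antisymm (iSup_le fun ν => eLpNorm_expMul_mono h0 (le_of_lt ν.2))
      (eLpNorm_expMul_le_of_forall_lt hφ fun ν hν =>
        le_iSup (fun ν : Iio a => eLpNorm (expMul ν φ) 2 volume) ⟨ν, hν⟩)
  change (Hardy.enormSup _).toReal = _
  rw [Hardy.enormSup, iSup_congr fun ν : Iio a => hs ν ν.2, ← ENNReal.mul_iSup, hsup,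
    ENNReal.toReal_mul, ENNReal.toReal_ofReal (Real.sqrt_nonneg _)]

theorem Hardy.ext_of_forall_mem {k : Fin 3} {F G : Hardy k a}
    (h : ∀ z ∈ halfPlane k a, F.toFun z = G.toFun z) : F = G := by
  refine Subtype.ext (funext fun z => ?_)
  by_cases hz : z ∈ halfPlane k a
  · exact h z hz
  · exact (F.2.2.1 z hz).trans (G.2.2.1 z hz).symm

theorem Hardy.exists_eq_hardyOfLaplace {k : Fin 3} (F : Hardy k a) :
    ∃ (φ : ℝ → ℂ) (h0 : ∀ x ≤ 0, φ x = 0) (h : MemLp (expMul a φ) 2 volume),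
      F = hardyOfLaplace k h0 h := by
  obtain ⟨C, hC⟩ := F.2.2.2
  have hd : DifferentiableOn ℂ (fun η => F.toFun (zeta k * η)) {η | η.im < a} :=
    DifferentiableOn.comp F.2.1 (differentiableOn_id.const_mul _) fun η hη => ⟨η, hη, rfl⟩
  obtain ⟨φ, h0, h, hφ⟩ := exists_eq_laplaceFourier hd hC
  refine ⟨φ, h0, h, Hardy.ext_of_forall_mem fun z hz => ?_⟩
  rw [hardyOfLaplace_toFun k h0 h z hz, ← hφ _ (by rw [halfPlane_eq] at hz; exact hz), ← mul_assoc,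
    zeta_mul_zeta_conjIdx, one_mul]

/-- An element of the Hardy space has a value on the line through the origin. -/
theorem Hardy.exists_hasLineValue_zero (ha : 0 ≤ a) {k : Fin 3} (F : Hardy k a) :
    ∃ g : ℝ → ℂ, HasLineValue k F.toFun 0 g ∧ (eLpNorm g 2 volume).toReal ≤ ‖F‖ ∧
      (g =ᵐ[volume] 0 → F = 0) := by
  obtain ⟨φ, h0, h, rfl⟩ := F.exists_eq_hardyOfLaplace
  have h1 := memLp_expMul h0 h ha
  refine ⟨_, hasLineValue_planch (hardyOfLaplace_toFun k h0 h) h0 ha h1, ?_, fun hg => ?_⟩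
  · rw [eLpNorm_planch, eLpNorm_congr_ae h1.coeFn_toLp, norm_hardyOfLaplace, ENNReal.toReal_mul,
      ENNReal.toReal_ofReal (Real.sqrt_nonneg _)]
    exact mul_le_mul_of_nonneg_left (ENNReal.toReal_mono h.2.ne (eLpNorm_expMul_mono h0 ha))
      (Real.sqrt_nonneg _)
  -- By Plancherel, a value that vanishes almost everywhere on the line through the origin forces `φ
  -- = 0` almost everywhere.
  · have h2 := eLpNorm_planch (h1.toLp _)
    rw [eLpNorm_congr_ae hg, eLpNorm_zero, eLpNorm_congr_ae h1.coeFn_toLp, eq_comm,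
      mul_eq_zero, or_iff_right (ENNReal.ofReal_pos.2 (by positivity)).ne',
      eLpNorm_eq_zero_iff h1.1 (by norm_num), expMul_zero] at h2
    have h3 : expMul a φ =ᵐ[volume] 0 := by
      filter_upwards [h2] with x hx
      simp [expMul, hx]
    rw [← norm_eq_zero, norm_hardyOfLaplace, eLpNorm_congr_ae h3, eLpNorm_zero]
    simp

end HardyLaplace

/-! ### The transform on the rays -/

section Rays

variable {a : ℝ}

/-- The component of `f` on the `k`-th ray, extended by zero to the line. -/
noncomputable def rayComponent (k : Fin 3) (f : ℂ → ℂ) : ℝ → ℂ :=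
  (Ioi (0 : ℝ)).indicator fun x => f ((x : ℂ) * zeta k)

theorem rayComponent_of_nonpos (k : Fin 3) (f : ℂ → ℂ) : ∀ x ≤ 0, rayComponent k f x = 0 :=
  fun _ hx => indicator_of_notMem (by simpa using hx) _

theorem sum_rayMeasure (a : ℝ) : ∑ k : Fin 3, rayMeasure k a = bundleMeasure (halfLineMeasure a) :=
  rfl

theorem memLp_rayComponent (k : Fin 3) (f : L2Rays a) :
    MemLp (expMul a (rayComponent k f)) 2 volume :=
  memLp_halfLineMeasure_iff.1 (memLp_bundleMeasure_iff.1 (Lp.memLp f) k)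

theorem norm_L2Rays_sq (f : L2Rays a) :
    ‖f‖ ^ 2 = ∑ k : Fin 3, (eLpNorm (expMul a (rayComponent k f)) 2 volume).toReal ^ 2 := by
  rw [norm_bundleMeasure_sq (sum_rayMeasure a) f]
  simp only [eLpNorm_halfLineMeasure]
  rfl

theorem indicator_rayIntegrand (k : Fin 3) (f : ℂ → ℂ) (z : ℂ) :
    (Ioi (0 : ℝ)).indicator (rayIntegrand k f z) = fun x : ℝ =>
      Complex.exp (-Complex.I * (zeta k * z) * x) * rayComponent k f x := by
  funext x
  by_cases hx : x ∈ Ioi (0 : ℝ)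
  · rw [indicator_of_mem hx, rayComponent, indicator_of_mem hx, rayIntegrand]
    ring_nf
  · rw [indicator_of_notMem hx, rayComponent, indicator_of_notMem hx, mul_zero]

theorem rayFourier_eq_laplaceFourier (k : Fin 3) (f : ℂ → ℂ) (z : ℂ) :
    rayFourier k f z = laplaceFourier (rayComponent k f) (zeta k * z) := by
  rw [rayFourier, ← integral_indicator measurableSet_Ioi, indicator_rayIntegrand]
  rfl

theorem integrableOn_rayIntegrand (k : Fin 3) (f : L2Rays a) {z : ℂ}
    (hz : z ∈ halfPlane (conjIdx k) a) : IntegrableOn (rayIntegrand k f z) (Ioi 0) volume := by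
  rw [← integrable_indicator_iff measurableSet_Ioi, indicator_rayIntegrand]
  rw [halfPlane_eq, conjIdx_conjIdx] at hz
  exact integrable_exp_mul (integrable_expMul (rayComponent_of_nonpos k f)
    (memLp_rayComponent k f) hz)

/-- The transform of `f` along the rays, as an element of the sum of the Hardy spaces. -/
noncomputable def rayTransform (f : L2Rays a) : HardySum a :=
  WithLp.toLp 2 fun k => hardyOfLaplace k (rayComponent_of_nonpos (conjIdx k) f)
    (memLp_rayComponent (conjIdx k) f)

theorem rayTransform_apply (f : L2Rays a) (k : Fin 3) : rayTransform f k =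
    hardyOfLaplace k (rayComponent_of_nonpos (conjIdx k) f) (memLp_rayComponent (conjIdx k) f) :=
  rfl

theorem rayTransform_toFun (f : L2Rays a) (k : Fin 3) {z : ℂ} (hz : z ∈ halfPlane k a) :
    (rayTransform f k).toFun z = rayFourier (conjIdx k) f z := by
  rw [rayFourier_eq_laplaceFourier, rayTransform_apply, hardyOfLaplace_toFun k _ _ z hz]

theorem norm_rayTransform (f : L2Rays a) : ‖rayTransform f‖ = √(2 * Real.pi) * ‖f‖ := by
  refine (sq_eq_sq₀ (norm_nonneg _) (by positivity)).1 ?_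
  -- The summand of index `k` comes from the ray of index `conjIdx k`; the sum is reindexed by this
  -- permutation.
  rw [PiLp.norm_sq_eq_of_L2, mul_pow, norm_L2Rays_sq, Finset.mul_sum,
    ← Equiv.sum_comp conjIdx fun k => _ * (eLpNorm (expMul a (rayComponent k f)) 2 volume).toReal ^ 2]
  refine Finset.sum_congr rfl fun k _ => ?_
  rw [rayTransform_apply, norm_hardyOfLaplace, mul_pow]

theorem integrableOn_rayIntegrand_conjIdx (f : L2Rays a) {k : Fin 3} {z : ℂ}
    (hz : z ∈ halfPlane k a) : IntegrableOn (rayIntegrand (conjIdx k) f z) (Ioi 0) volume :=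
  integrableOn_rayIntegrand _ f (by rwa [conjIdx_conjIdx])

theorem ae_ray_of_ae {p : ℂ → Prop} (h : ∀ᵐ z ∂(∑ k : Fin 3, rayMeasure k a), p z) (k : Fin 3) :
    ∀ᵐ x : ℝ ∂volume.restrict (Ioi (0 : ℝ)), p ((x : ℂ) * zeta k) :=
  restrict_absolutelyContinuous_halfLineMeasure a (ae_bundleMeasure_iff.1 h k)

variable (a) in
/-- The transform along the rays as a linear map. -/
noncomputable def rayTransformₗ : L2Rays a →ₗ[ℂ] HardySum a where
  toFun := rayTransform
  map_add' f g := by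
    refine PiLp.ext fun k => Hardy.ext_of_forall_mem fun z hz => ?_
    change (rayTransform (f + g) k).toFun z =
      (rayTransform f k).toFun z + (rayTransform g k).toFun z
    rw [rayTransform_toFun _ k hz, rayTransform_toFun _ k hz, rayTransform_toFun _ k hz,
      rayFourier, rayFourier, rayFourier, ← integral_add (integrableOn_rayIntegrand_conjIdx f hz)
        (integrableOn_rayIntegrand_conjIdx g hz)]
    refine integral_congr_ae ?_
    filter_upwards [ae_ray_of_ae (Lp.coeFn_add f g) (conjIdx k)] with x hx
    simp only [rayIntegrand, hx, Pi.add_apply, mul_add]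
  map_smul' c f := by
    refine PiLp.ext fun k => Hardy.ext_of_forall_mem fun z hz => ?_
    change (rayTransform (c • f) k).toFun z = c * (rayTransform f k).toFun z
    rw [rayTransform_toFun _ k hz, rayTransform_toFun _ k hz, rayFourier, rayFourier,
      ← integral_const_mul]
    refine integral_congr_ae ?_
    filter_upwards [ae_ray_of_ae (Lp.coeFn_smul c f) (conjIdx k)] with x hx
    simp only [rayIntegrand, hx, Pi.smul_apply, smul_eq_mul, mul_left_comm c]

/-- Paley–Wiener represents each summand as a Fourier–Laplace transform; the three functions so
obtained are glued to one function on the rays. -/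
theorem rayTransform_surjective : Function.Surjective (rayTransform (a := a)) := by
  intro F
  choose φ h0 h hF using fun k => (F k).exists_eq_hardyOfLaplace
  have hind (k : Fin 3) : (Ioi (0 : ℝ)).indicator (φ k) = φ k := by
    refine indicator_eq_self.2 fun x hx => ?_
    by_contra hx'
    exact hx (h0 k x (not_lt.1 hx'))
  obtain ⟨f, hf⟩ := exists_bundle_eq (sum_rayMeasure a)
    ((halfLineMeasure_absolutelyContinuous a).trans Measure.restrict_le_self.absolutelyContinuous)
    (h := fun k => φ (conjIdx k)) fun k => memLp_halfLineMeasure_iff.2 (by rw [hind]; exact h _)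
  refine ⟨f, PiLp.ext fun k => Hardy.ext_of_forall_mem fun z hz => ?_⟩
  rw [rayTransform_toFun _ k hz, hF k, hardyOfLaplace_toFun k (h0 k) (h k) z hz, laplaceFourier,
    rayFourier, ← hind k, ← integral_indicator measurableSet_Ioi]
  have h1 := restrict_absolutelyContinuous_halfLineMeasure a (hf (conjIdx k))
  have h2 := (ae_restrict_iff' measurableSet_Ioi).1 h1
  refine integral_congr_ae ?_
  filter_upwards [h2] with x hx
  by_cases hx0 : x ∈ Ioi (0 : ℝ)
  · have := hx hx0
    rw [conjIdx_conjIdx] at this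
    rw [indicator_of_mem hx0, indicator_of_mem hx0, ← this, rayIntegrand]
    ring_nf
  · rw [indicator_of_notMem hx0, indicator_of_notMem hx0, mul_zero]

theorem rayTransform_bijective : Function.Bijective (rayTransformₗ a) := by
  refine ⟨(injective_iff_map_eq_zero _).2 fun f hf => ?_, rayTransform_surjective⟩
  have h1 : ‖rayTransform f‖ = 0 := norm_eq_zero.2 hf
  rw [norm_rayTransform, mul_eq_zero, or_iff_right (by positivity)] at h1
  exact norm_eq_zero.1 h1

theorem norm_ofBijective_symm_le (F : HardySum a) :
    ‖(LinearEquiv.ofBijective (rayTransformₗ a) rayTransform_bijective).symm F‖ ≤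
      (√(2 * Real.pi))⁻¹ * ‖F‖ := by
  obtain ⟨f, rfl⟩ := rayTransform_surjective F
  have h1 : (LinearEquiv.ofBijective (rayTransformₗ a) rayTransform_bijective).symm
      (rayTransform f) = f := LinearEquiv.symm_apply_apply _ f
  rw [h1, norm_rayTransform, inv_mul_cancel_left₀ (by positivity)]

variable (a) in
/-- The transform along the rays is an isomorphism onto the sum of the Hardy spaces. -/
noncomputable def rayTransformEquiv : L2Rays a ≃L[ℂ] HardySum a :=
  (LinearEquiv.ofBijective (rayTransformₗ a) rayTransform_bijective).toContinuousLinearEquivOfBounds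
    (√(2 * Real.pi)) (√(2 * Real.pi))⁻¹ (fun f => (norm_rayTransform f).le) norm_ofBijective_symm_le

theorem rayTransformEquiv_apply (f : L2Rays a) : rayTransformEquiv a f = rayTransform f := rfl

end Rays

/-! ### The values on the lines through the origin -/

theorem HasLineValue.congr_ae {k : Fin 3} {F : ℂ → ℂ} {s : ℝ} {g g' : ℝ → ℂ}
    (h : HasLineValue k F s g) (hg : g' =ᵐ[volume] g) : HasLineValue k F s g' := by
  refine ⟨(memLp_congr_ae hg).2 h.1, h.2.1.congr fun ν => eLpNorm_congr_ae ?_, ?_⟩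
  · filter_upwards [hg] with μ hμ
    rw [hμ]
  · filter_upwards [hg, h.2.2] with μ hμ h1
    rwa [hμ]

theorem sum_map_volume :
    ∑ k : Fin 3, (volume : Measure ℝ).map (fun x : ℝ => (x : ℂ) * zeta k) = bundleMeasure volume :=
  rfl

theorem L2Lines.ext {f g : L2Lines}
    (h : ∀ k : Fin 3, ∀ᵐ x : ℝ, f ((x : ℂ) * zeta k) = g ((x : ℂ) * zeta k)) : f = g :=
  Lp.ext (ae_bundleMeasure_iff.2 h)

theorem ae_line_of_ae {p : ℂ → Prop}
    (h : ∀ᵐ z ∂(∑ k : Fin 3, (volume : Measure ℝ).map (fun x : ℝ => (x : ℂ) * zeta k)), p z)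
    (k : Fin 3) : ∀ᵐ x : ℝ, p ((x : ℂ) * zeta k) :=
  ae_bundleMeasure_iff.1 h k

section Lines

variable {a : ℝ}

/-- The clause `j = 0 → F = 0` becomes injectivity once the choice of `j` is known to be linear in
`F`. -/
theorem exists_lineValue (ha : 0 ≤ a) (F : HardySum a) : ∃ j : L2Lines,
    (∀ k : Fin 3, HasLineValue k (F k).toFun 0 fun μ : ℝ => j ((μ : ℂ) * zeta k)) ∧
      ‖j‖ ≤ ‖F‖ ∧ (j = 0 → F = 0) := by
  choose g hg hn hz using fun k => (F k).exists_hasLineValue_zero ha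
  obtain ⟨j, hj⟩ := exists_bundle_eq sum_map_volume Measure.AbsolutelyContinuous.rfl fun k => (hg k).1
  refine ⟨j, fun k => (hg k).congr_ae (hj k), ?_, fun hj0 => PiLp.ext fun k => hz k ?_⟩
  · refine (sq_le_sq₀ (norm_nonneg _) (norm_nonneg _)).1 ?_
    rw [PiLp.norm_sq_eq_of_L2, norm_bundleMeasure_sq sum_map_volume]
    refine Finset.sum_le_sum fun k _ => ?_
    rw [eLpNorm_congr_ae (hj k)]
    exact pow_le_pow_left₀ ENNReal.toReal_nonneg (hn k) 2
  · refine (hj k).symm.trans ?_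
    rw [hj0]
    exact ae_line_of_ae (Lp.coeFn_zero _ _ _) k

/-- The values are chosen separately for each `F`; linearity follows from uniqueness of pointwise
limits almost everywhere. -/
theorem exists_lineValueMap (ha : 0 ≤ a) : ∃ J : HardySum a →L[ℂ] L2Lines, Function.Injective J ∧
    ∀ (F : HardySum a) (k : Fin 3),
      HasLineValue k (F k).toFun 0 fun μ : ℝ => J F ((μ : ℂ) * zeta k) := by
  choose j hj hn hz using exists_lineValue (a := a) ha
  let J₀ : HardySum a →ₗ[ℂ] L2Lines :=
    { toFun := j
      map_add' := fun F G => L2Lines.ext fun k => by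
        filter_upwards [(hj (F + G) k).2.2, (hj F k).2.2, (hj G k).2.2,
          ae_line_of_ae (Lp.coeFn_add (j F) (j G)) k] with μ h1 h2 h3 h4
        rw [h4]
        exact tendsto_nhds_unique h1 (h2.add h3)
      map_smul' := fun c F => L2Lines.ext fun k => by
        filter_upwards [(hj (c • F) k).2.2, (hj F k).2.2,
          ae_line_of_ae (Lp.coeFn_smul c (j F)) k] with μ h1 h2 h3
        rw [RingHom.id_apply, h3]
        exact tendsto_nhds_unique h1 (h2.const_smul c) }
  refine ⟨J₀.mkContinuous 1 fun F => by rw [one_mul]; exact hn F, ?_, hj⟩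
  exact (injective_iff_map_eq_zero _).2 fun F hF => hz F hF

end Lines

/-! ### The transforms on the triangle -/

section Triangle

variable {a : ℝ}

theorem rayFourier_forall_eq (k : Fin 3) (f : ℂ → ℂ) : ∀ z ∈ halfPlane (conjIdx k) a,
    rayFourier k f z = laplaceFourier (rayComponent k f) (zeta (conjIdx (conjIdx k)) * z) :=
  fun z _ => by rw [conjIdx_conjIdx, rayFourier_eq_laplaceFourier]

theorem setIntegral_rayIntegrand_boundary (k : Fin 3) (f : ℂ → ℂ) (a N μ : ℝ) :
    ∫ x in Ioc 0 N, rayIntegrand k f (zeta (conjIdx k) * ((μ : ℂ) + (a : ℂ) * Complex.I)) x =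
      laplaceFourier ((Ioc 0 N).indicator (expMul a (rayComponent k f))) μ := by
  rw [laplaceFourier, ← integral_indicator measurableSet_Ioc]
  refine integral_congr_ae (ae_of_all _ fun x => ?_)
  by_cases hx : x ∈ Ioc 0 N
  · simp only [indicator_of_mem hx]
    rw [← exp_mul_eq_expMul, rayComponent, indicator_of_mem (show x ∈ Ioi 0 from hx.1),
      rayIntegrand]
    congr 2
    linear_combination (-Complex.I * (μ + a * Complex.I) * x) * zeta_conjIdx_mul_zeta k
  · simp only [indicator_of_notMem hx, mul_zero]

theorem exists_boundaryValue (f : L2Rays a) (k : Fin 3) : ∃ g : ℝ → ℂ,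
    HasLineValue (conjIdx k) (rayFourier k f) a g ∧
    Tendsto (fun N : ℝ => eLpNorm (fun μ : ℝ =>
      (∫ x in Ioc 0 N, rayIntegrand k f
        (zeta (conjIdx k) * ((μ : ℂ) + (a : ℂ) * Complex.I)) x) - g μ) 2 volume) atTop (𝓝 0) := by
  refine ⟨_, hasLineValue_planch (rayFourier_forall_eq k f) (rayComponent_of_nonpos k f) le_rfl
    (memLp_rayComponent k f), ?_⟩
  simp only [setIntegral_rayIntegrand_boundary]
  exact tendsto_eLpNorm_laplaceFourier_truncation_sub (rayComponent_of_nonpos k f) _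

theorem analyticAt_rayFourier (f : L2Rays a) (k : Fin 3) {z : ℂ}
    (hz : z ∈ halfPlane (conjIdx k) a) : AnalyticAt ℂ (rayFourier k f) z :=
  DifferentiableOn.analyticAt (s := halfPlane (conjIdx k) a)
    (fun _ hw => (differentiableAt_of_forall_eq (rayFourier_forall_eq k f)
      (rayComponent_of_nonpos k f) (memLp_rayComponent k f) hw).differentiableWithinAt)
    ((isOpen_halfPlane _ a).mem_nhds hz)

end Triangle

end RayBundle

open RayBundle in
theorem theorem1p2 (a : ℝ) (ha : 0 ≤ a) :
    -- the ray transforms are an isomorphism of `L²(l, a)` onto the sum of the Hardy spaces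
    (∃ Φ : L2Rays a ≃L[ℂ] HardySum a,
      (∀ (f : L2Rays a) (k : Fin 3), ∀ z ∈ halfPlane k a,
        IntegrableOn (rayIntegrand (conjIdx k) f z) (Ioi 0) volume ∧
        ((Φ f) k).toFun z = rayFourier (conjIdx k) f z) ∧
      ∀ f : L2Rays a, ‖Φ f‖ = √(2 * Real.pi) * ‖f‖) ∧
    -- the sum of the Hardy spaces lies in `L²(L)`
    (∃ J : HardySum a →L[ℂ] L2Lines, Function.Injective J ∧
      ∀ (F : HardySum a) (k : Fin 3),
        HasLineValue k (F k).toFun 0 (fun μ : ℝ => J F ((μ : ℂ) * zeta k))) ∧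
    ∀ f : L2Rays a,
      -- existence at the points of the triangle: each integral converges absolutely off the
      -- boundary line of its half-plane
      (∀ z ∈ triangle a, ∀ k : Fin 3, z ∉ frontier (halfPlane (conjIdx k) a) →
        IntegrableOn (rayIntegrand k f z) (Ioi 0) volume) ∧
      -- on that boundary line it exists in the sense of Plancherel
      (∀ k : Fin 3, ∃ g : ℝ → ℂ,
        HasLineValue (conjIdx k) (rayFourier k f) a g ∧
        Tendsto (fun N : ℝ => eLpNorm (fun μ : ℝ =>
            (∫ x in Ioc 0 N, rayIntegrand k f
              (zeta (conjIdx k) * ((μ : ℂ) + (a : ℂ) * Complex.I)) x) - g μ) 2 volume)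
          atTop (𝓝 0)) ∧
      -- inside the triangle all three exist and are holomorphic
      (∀ z ∈ interior (triangle a), ∀ k : Fin 3,
        IntegrableOn (rayIntegrand k f z) (Ioi 0) volume ∧
        AnalyticAt ℂ (rayFourier k f) z) := by
  refine ⟨⟨rayTransformEquiv a, fun f k z hz => ⟨integrableOn_rayIntegrand_conjIdx f hz, ?_⟩,
    fun f => ?_⟩, exists_lineValueMap ha, fun f => ⟨fun z hz k hk => ?_, exists_boundaryValue f,
    fun z hz k => ?_⟩⟩
  · rw [rayTransformEquiv_apply, rayTransform_toFun f k hz]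
  · rw [rayTransformEquiv_apply, norm_rayTransform]
  · exact integrableOn_rayIntegrand k f (mem_halfPlane_of_mem_triangle hz hk)
  · have h := mem_halfPlane_of_mem_interior_triangle hz (conjIdx k)
    exact ⟨integrableOn_rayIntegrand k f h, analyticAt_rayFourier f k h⟩
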